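/- Let $\beta$ be an indeterminate and $k=\mathbb{Q}(\beta)$. Let $\phi_n$ ($n\in\mathbb{Z}$) be neutral fermions, i.e. generators of the $k$-algebra $\mathcal{A}$ with relations $\phi_m\phi_n+\phi_n\phi_m=2(-1)^m\delta_{m+n,0}$. Let $\mathcal{E}$ be the right $\mathcal{A}$-module generated by a vector $\langle 0|$ with $\langle 0|\phi_n=0$ for $n>0$; it has the $k$-basis $\langle 0|\phi_{m_1}\cdots\phi_{m_r}$ ($r\ge 0$, $0\ge m_1>\dots>m_r$). Let $\langle w|\mapsto\langle w|0\rangle$ be the linear functional on $\mathcal{E}$ with $\langle 0|0\rangle=1$, $\langle 0|\phi_0|0\rangle=0$ and $\langle w|\phi_{-n}|0\rangle=0$ for $n>0$ and all $\langle w|\in\mathcal{E}$. All operators below act on $\mathcal{E}$ from the right (infinite sums being locally finite): * $\phi^{(\beta)}_n$ ($n\in\mathbb{Z}$) is defined by $\sum_{n\ge 0}\phi^{(\beta)}_nz^n=\sum_{n\ge 0}\phi_n\left(z+\frac{\beta}{2}\right)^n$ and $\sum_{n>0}\phi^{(\beta)}_{-n}z^{-n}=\sum_{n>0}\phi_{-n}\left(\frac{z^{-1}}{1+\frac{\beta}{2}z^{-1}}\right)^n$;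 * $b_m=\frac14\sum_{i\in\mathbb{Z}}(-1)^i\phi_{-i-m}\phi_i$ for odd $m$, and for $m\ge 1$ the operator $b^{(\beta)}_m$ is obtained from the odd polynomial $\frac12\left\{\left(X-\frac{\beta}{2}\right)^m-\left(-X-\frac{\beta}{2}\right)^m\right\}$ by replacing $X^j$ with $b_j$; * $\mathcal{H}^{(\beta)}=2\sum_{n\ge 1}\frac{p_n}{n}b^{(\beta)}_n$, where $p_1,p_2,\dots$ are commuting indeterminates, and $\Theta=2\sum_{n=1,3,5,\dots}\left(\frac{\beta}{2}\right)^n\frac{b_{-n}}{n}$. Thus $\langle 0|e^{\mathcal{H}^{(\beta)}}\phi^{(\beta)}_n e^{\Theta}\phi^{(\beta)}_0e^{\Theta}|0\rangle\in k[[p_1,p_2,\dots]]$. Let $x=(x_1,x_2,\dots)$, $p_n(x)=\sum_i x_i^n$, $a\oplus b=a+b+\beta ab$, $a\ominus b=\frac{a-b}{1+\beta b}$ and $\bar a=0\ominus a=\frac{-a}{1+\beta a}$. For $n\ge 1$ let $GQ_n(x)$ be the $K$-theoretic $Q$-function of the one-row partition $(n)$, i.e. the formal power series in $x_1,x_2,\dots$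 such that, for every $N\ge 1$, $GQ_n(x_1,\dots,x_N,0,0,\dots)$ is the polynomial $$\frac{1}{(N-1)!}\sum_{w\in S_N}w\left[(x_1\oplus x_1)\,x_1^{n-1}\prod_{j=2}^N\frac{x_1\oplus x_j}{x_1\ominus x_j}\right],$$ where $w$ permutes $x_1,\dots,x_N$. For $n\le 0$ let $GQ_n(x)$ be the coefficient of $z^n$ in $$\frac{1}{1+\beta z^{-1}}\prod_{i=1}^\infty\frac{1+(z+\beta)x_i}{1+(z+\beta)\bar x_i}\ \in\ k((z^{-1}))[[x_1,x_2,\dots]].\qquad(*)$$ **Theorem.** Under the substitution $p_n\mapsto p_n(x)$ ($n\geq 1$), for every integer $n$ we have $$GQ_n(x)=\langle 0|e^{\mathcal{H}^{(\beta)}}\phi^{(\beta)}_n e^{\Theta}\phi^{(\beta)}_0e^{\Theta}|0\rangle .$$ Moreover, under the same substitution, the generating function $\sum_{n\in\mathbb{Z}}\langle 0|e^{\mathcal{H}^{(\beta)}}\phi^{(\beta)}_n e^{\Theta}\phi^{(\beta)}_0e^{\Theta}|0\rangle\,z^n$ equals $(*)$ in $k((z^{-1}))[[x_1,x_2,\dots]]$,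 i.e. the two have the same coefficient of $z^n$ for every $n\in\mathbb{Z}$. -/

import Mathlib

namespace KQ

noncomputable section

/-! ### Neutral fermions and the right Fock space -/

/-- The ground field `k = ℚ(β)`. -/
abbrev K : Type := RatFunc ℚ

/-- The deformation parameter `β`. -/
def beta : K := RatFunc.X

/-- The right Fock space `𝓔`: the `k`-vector space with basis
`⟨0|φ_{-s₁} φ_{-s₂} ⋯ φ_{-s_r}` for `0 ≤ s₁ < s₂ < ⋯ < s_r`; the basis vector is
indexed by the finite set `S = {s₁, …, s_r}`. -/
abbrev E : Type := Finset ℕ →₀ K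

/-- The basis vector `⟨0|φ_{-s₁} ⋯ φ_{-s_r}` for `S = {s₁ < ⋯ < s_r}`. -/
def bra (S : Finset ℕ) : E := Finsupp.single S 1

/-- The vacuum vector `⟨0|`. -/
def vac : E := bra ∅

/-- The sign picked up by moving a fermion of index `±k` from the right end of the word indexed
by `S` to the left past all letters `φ_{-s}` with `s > k`. -/
def crossSign (k : ℕ) (S : Finset ℕ) : K := (-1) ^ (S.filter (fun s => k < s)).card

/-- Insertion of the letter `φ_{-k}` in a word. -/
def create (k : ℕ) : E →ₗ[K] E :=
  Finsupp.linearCombination K fun S =>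
    if k ∈ S then 0 else crossSign k S • bra (insert k S)

/-- Deletion of the letter `φ_{-k}` from a word. -/
def annihilate (k : ℕ) : E →ₗ[K] E :=
  Finsupp.linearCombination K fun S =>
    if k ∈ S then crossSign k S • bra (S.erase k) else 0

/-- The right action of the neutral fermion: `phi n w` is `⟨w|φ_n`. It is the action forced by
`[φ_m, φ_n]₊ = 2(-1)^m δ_{m+n,0}` and `⟨0|φ_n = 0` for `n > 0`
(see `phi_anticomm`, `phi_vac` and `phi_bra`). Since the action is on the right,
`⟨w|φ_m φ_n` is `phi n (phi m w)`. -/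
def phi (n : ℤ) : E →ₗ[K] E :=
  if n < 0 then create n.natAbs
  else if n = 0 then create 0 + annihilate 0
  else (2 * (-1) ^ n.natAbs : K) • annihilate n.natAbs

/-- The vacuum expectation `⟨w| ↦ ⟨w|0⟩`, see `pairVac_vac`, `pairVac_phi_neg`,
`pairVac_phi_zero` and `pairVac_unique`. -/
def pairVac : E →ₗ[K] K := Finsupp.lapply ∅

lemma create_bra (k : ℕ) (S : Finset ℕ) :
    create k (bra S) = if k ∈ S then 0 else crossSign k S • bra (insert k S) := by
  simp [create, bra]

lemma annihilate_bra (k : ℕ) (S : Finset ℕ) :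
    annihilate k (bra S) = if k ∈ S then crossSign k S • bra (S.erase k) else 0 := by
  simp [annihilate, bra]

lemma hom_ext {M : Type*} [AddCommGroup M] [Module K M] {f g : E →ₗ[K] M}
    (h : ∀ S, f (bra S) = g (bra S)) : f = g :=
  Finsupp.lhom_ext' fun S => LinearMap.ext_ring (h S)

lemma crossSign_insert {j k : ℕ} {S : Finset ℕ} (h : k ∉ S) :
    crossSign j (insert k S) = (if j < k then -1 else 1) * crossSign j S := by
  unfold crossSign
  rw [Finset.filter_insert]
  split_ifs with hjk
  · rw [Finset.card_insert_of_notMem (by simp [h]), pow_succ]; ring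
  · ring

lemma crossSign_erase {j k : ℕ} {S : Finset ℕ} (h : k ∈ S) :
    crossSign j (S.erase k) = (if j < k then -1 else 1) * crossSign j S := by
  have h2 := crossSign_insert (j := j) (Finset.notMem_erase k S)
  rw [Finset.insert_erase h] at h2
  rw [h2]; split_ifs <;> ring

lemma crossSign_mul_self (k : ℕ) (S : Finset ℕ) : crossSign k S * crossSign k S = 1 := by
  unfold crossSign
  rw [← mul_pow]; simp

lemma create_create (j k : ℕ) (w : E) : create j (create k w) + create k (create j w) = 0 := by
  suffices h : create j ∘ₗ create k + create k ∘ₗ create j = 0 from LinearMap.congr_fun h w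
  refine hom_ext fun S => ?_
  simp only [LinearMap.add_apply, LinearMap.comp_apply, LinearMap.zero_apply, create_bra]
  rcases eq_or_ne j k with rfl | hjk
  · split_ifs <;> simp [create_bra]
  · by_cases hj : j ∈ S <;> by_cases hk : k ∈ S <;> simp [hj, hk, create_bra, hjk, hjk.symm]
    rw [Finset.insert_comm, crossSign_insert hk, crossSign_insert hj, smul_smul, smul_smul,
      ← add_smul]
    rcases lt_or_gt_of_ne hjk with h | h <;> simp [h, h.not_gt, mul_comm]

lemma annihilate_annihilate (j k : ℕ) (w : E) :
    annihilate j (annihilate k w) + annihilate k (annihilate j w) = 0 := by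
  suffices h : annihilate j ∘ₗ annihilate k + annihilate k ∘ₗ annihilate j = 0 from
    LinearMap.congr_fun h w
  refine hom_ext fun S => ?_
  simp only [LinearMap.add_apply, LinearMap.comp_apply, LinearMap.zero_apply, annihilate_bra]
  rcases eq_or_ne j k with rfl | hjk
  · split_ifs <;> simp [annihilate_bra]
  · by_cases hj : j ∈ S <;> by_cases hk : k ∈ S <;> simp [hj, hk, annihilate_bra, hjk, hjk.symm]
    rw [Finset.erase_right_comm, crossSign_erase hk, crossSign_erase hj, smul_smul, smul_smul,
      ← add_smul]
    rcases lt_or_gt_of_ne hjk with h | h <;> simp [h, h.not_gt, mul_comm]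

lemma create_annihilate (j k : ℕ) (w : E) :
    create j (annihilate k w) + annihilate k (create j w) = if j = k then w else 0 := by
  suffices h : create j ∘ₗ annihilate k + annihilate k ∘ₗ create j =
      if j = k then LinearMap.id else 0 by
    have := LinearMap.congr_fun h w
    split_ifs at this ⊢ <;> simpa using this
  refine hom_ext fun S => ?_
  simp only [LinearMap.add_apply, LinearMap.comp_apply, create_bra, annihilate_bra]
  rcases eq_or_ne j k with rfl | hjk
  · by_cases hj : j ∈ S
    · simp [hj, create_bra, crossSign_erase, smul_smul, crossSign_mul_self]
    · simp [hj, annihilate_bra, crossSign_insert, smul_smul, crossSign_mul_self]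
  · by_cases hj : j ∈ S <;> by_cases hk : k ∈ S <;>
      simp [hj, hk, annihilate_bra, create_bra, hjk, hjk.symm]
    rw [Finset.erase_insert_of_ne hjk, crossSign_erase hk, crossSign_insert hj, smul_smul,
      smul_smul, ← add_smul]
    rcases lt_or_gt_of_ne hjk with h | h <;> simp [h, h.not_gt, mul_comm]

/-- The defining relation `[φ_m, φ_n]₊ = 2(-1)^m δ_{m+n,0}`. -/
lemma phi_anticomm (m n : ℤ) (w : E) :
    phi n (phi m w) + phi m (phi n w) =
      if m + n = 0 then (2 * (-1) ^ m.natAbs : K) • w else 0 := by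
  have cc := fun j k => create_create j k w
  have aa := fun j k => annihilate_annihilate j k w
  have ca := fun j k => create_annihilate j k w
  rcases lt_trichotomy m 0 with hm | rfl | hm <;> rcases lt_trichotomy n 0 with hn | rfl | hn
  · have h0 : m + n ≠ 0 := by omega
    simp only [phi, hm, hn, h0, if_true, if_false]
    exact cc _ _
  · have h0 : m + 0 ≠ 0 := by omega
    have h1 : m.natAbs ≠ 0 := by omega
    have e1 := cc 0 m.natAbs
    have e2 := ca m.natAbs 0
    simp only [h1, if_false] at e2
    simp only [phi, hm, h0, lt_irrefl, if_true, if_false, LinearMap.add_apply, map_add]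
    linear_combination (norm := module) e1 + e2
  · have h1 : ¬ n < 0 := by omega
    have h2 : n ≠ 0 := by omega
    have e := ca m.natAbs n.natAbs
    simp only [phi, hm, h1, h2, if_true, if_false, LinearMap.smul_apply, map_smul]
    rw [← smul_add, add_comm (annihilate _ _), e]
    by_cases h : m + n = 0
    · have h3 : m.natAbs = n.natAbs := by omega
      simp [h, h3]
    · have h3 : m.natAbs ≠ n.natAbs := by omega
      simp [h, h3]
  · have h0 : 0 + n ≠ 0 := by omega
    have h1 : n.natAbs ≠ 0 := by omega
    have e1 := cc 0 n.natAbs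
    have e2 := ca n.natAbs 0
    simp only [h1, if_false] at e2
    simp only [phi, hn, h0, lt_irrefl, if_true, if_false, LinearMap.add_apply, map_add]
    linear_combination (norm := module) e1 + e2
  · have e1 := cc 0 0
    have e2 := ca 0 0
    have e3 := aa 0 0
    simp only [if_true] at e2
    simp only [phi, lt_irrefl, if_true, if_false, LinearMap.add_apply, map_add, add_zero,
      Int.natAbs_zero, pow_zero, mul_one, two_smul]
    linear_combination (norm := module) e1 + e2 + e2 + e3
  · have h0 : 0 + n ≠ 0 := by omega
    have h1 : ¬ n < 0 := by omega
    have h2 : n ≠ 0 := by omega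
    have h3 : (0 : ℕ) ≠ n.natAbs := by omega
    have e1 := aa 0 n.natAbs
    have e2 := ca 0 n.natAbs
    simp only [h3, if_false] at e2
    simp only [phi, h0, h1, h2, lt_irrefl, if_true, if_false, LinearMap.add_apply, map_add,
      LinearMap.smul_apply, map_smul]
    have e3 : (2 * (-1) ^ n.natAbs : K) •
        ((annihilate 0 (annihilate n.natAbs w) + annihilate n.natAbs (annihilate 0 w)) +
          (create 0 (annihilate n.natAbs w) + annihilate n.natAbs (create 0 w))) = 0 := by
      rw [e1, e2, add_zero, smul_zero]
    refine Eq.trans ?_ e3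
    simp only [smul_add]
    abel
  · have h1 : ¬ m < 0 := by omega
    have h2 : m ≠ 0 := by omega
    have e := ca n.natAbs m.natAbs
    simp only [phi, hn, h1, h2, if_true, if_false, LinearMap.smul_apply, map_smul]
    rw [← smul_add, e]
    by_cases h : m + n = 0
    · have h3 : n.natAbs = m.natAbs := by omega
      simp [h, h3]
    · have h3 : n.natAbs ≠ m.natAbs := by omega
      simp [h, h3]
  · have h0 : m + 0 ≠ 0 := by omega
    have h1 : ¬ m < 0 := by omega
    have h2 : m ≠ 0 := by omega
    have h3 : (0 : ℕ) ≠ m.natAbs := by omega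
    have e1 := aa 0 m.natAbs
    have e2 := ca 0 m.natAbs
    simp only [h3, if_false] at e2
    simp only [phi, h0, h1, h2, lt_irrefl, if_true, if_false, LinearMap.add_apply, map_add,
      LinearMap.smul_apply, map_smul]
    have e3 : (2 * (-1) ^ m.natAbs : K) •
        ((annihilate 0 (annihilate m.natAbs w) + annihilate m.natAbs (annihilate 0 w)) +
          (create 0 (annihilate m.natAbs w) + annihilate m.natAbs (create 0 w))) = 0 := by
      rw [e1, e2, add_zero, smul_zero]
    refine Eq.trans ?_ e3
    simp only [smul_add]
    abel
  · have h0 : m + n ≠ 0 := by omega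
    have h1 : ¬ m < 0 := by omega
    have h2 : m ≠ 0 := by omega
    have h3 : ¬ n < 0 := by omega
    have h4 : n ≠ 0 := by omega
    have e := aa m.natAbs n.natAbs
    simp only [phi, h0, h1, h2, h3, h4, if_false, LinearMap.smul_apply, map_smul]
    rw [smul_comm, ← smul_add, ← smul_add, add_comm, e, smul_zero, smul_zero]

/-- `⟨0|φ_n = 0` for `n > 0`. -/
lemma phi_vac {n : ℤ} (hn : 0 < n) : phi n vac = 0 := by
  have h1 : ¬ n < 0 := by omega
  have h2 : n ≠ 0 := by omega
  simp [phi, h1, h2, vac, annihilate_bra]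

/-- The basis vectors are the ordered words in the `φ_{-s}` applied to `⟨0|`. -/
lemma phi_bra {k : ℕ} {S : Finset ℕ} (h : ∀ s ∈ S, s < k) :
    phi (-(k : ℤ)) (bra S) = bra (insert k S) := by
  have hk : k ∉ S := fun hk => lt_irrefl _ (h k hk)
  have hs : crossSign k S = 1 := by
    have : S.filter (fun s => k < s) = ∅ :=
      Finset.filter_eq_empty_iff.2 fun s hs => (h s hs).not_gt
    simp [crossSign, this]
  rcases Nat.eq_zero_or_pos k with rfl | hpos
  · simp [phi, create_bra, annihilate_bra, hk, hs]
  · simp [phi, hpos, create_bra, hk, hs]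

lemma pairVac_vac : pairVac vac = 1 := by simp [pairVac, vac, bra]

/-- `φ_{-k}|0⟩ = 0` for `k > 0`. -/
lemma pairVac_phi_neg {n : ℤ} (hn : n < 0) (w : E) : pairVac (phi n w) = 0 := by
  suffices h : pairVac ∘ₗ phi n = 0 from LinearMap.congr_fun h w
  refine hom_ext fun S => ?_
  simp only [phi, hn, if_true, LinearMap.comp_apply, create_bra]
  split_ifs
  · simp
  · simp [pairVac, bra]

lemma pairVac_phi_zero : pairVac (phi 0 vac) = 0 := by
  simp only [phi, vac, lt_irrefl, if_false, if_true, LinearMap.add_apply, create_bra,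
    annihilate_bra]
  simp [pairVac, bra]

lemma pairVac_unique (f : E →ₗ[K] K) (h1 : f vac = 1) (h2 : ∀ n < 0, ∀ w, f (phi n w) = 0)
    (h3 : f (phi 0 vac) = 0) : f = pairVac := by
  refine hom_ext fun S => ?_
  rcases S.eq_empty_or_nonempty with rfl | hS
  · exact h1.trans pairVac_vac.symm
  · have hlt : ∀ s ∈ S.erase (S.max' hS), s < S.max' hS := fun s hs =>
      lt_of_le_of_ne (S.le_max' s (Finset.mem_of_mem_erase hs)) (Finset.ne_of_mem_erase hs)
    have hb := phi_bra hlt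
    rw [Finset.insert_erase (S.max'_mem hS)] at hb
    rcases Nat.eq_zero_or_pos (S.max' hS) with h0 | hpos
    · have : S.erase (S.max' hS) = ∅ := by
        refine Finset.eq_empty_of_forall_notMem fun s hs => ?_
        have := hlt s hs
        omega
      rw [this, h0] at hb
      rw [← hb]
      exact h3.trans pairVac_phi_zero.symm
    · have hneg : -((S.max' hS : ℕ) : ℤ) < 0 := by omega
      rw [← hb, h2 _ hneg, pairVac_phi_neg hneg]

/-- `𝓔_0 ⊕ ⋯ ⊕ 𝓔_{-d}`, the span of the words of degree at least `-d`. -/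
def EFilt (d : ℤ) : Submodule K E := Finsupp.supported K K {S | ((∑ s ∈ S, s : ℕ) : ℤ) ≤ d}

lemma exists_mem_EFilt (w : E) : ∃ d : ℕ, w ∈ EFilt d := by
  refine ⟨w.support.sup fun S => ∑ s ∈ S, s, ?_⟩
  rw [EFilt, Finsupp.mem_supported]
  intro S hS
  have := Finset.le_sup (f := fun S : Finset ℕ => ∑ s ∈ S, s) hS
  exact Int.ofNat_le.2 this

lemma EFilt_neg {d : ℤ} (hd : d < 0) {w : E} (hw : w ∈ EFilt d) : w = 0 := by
  rw [EFilt, Finsupp.mem_supported] at hw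
  rw [← Finsupp.support_eq_empty, Finset.eq_empty_iff_forall_notMem]
  intro S hS
  have := hw hS
  simp only [Set.mem_ofPred_eq] at this
  omega

lemma EFilt_mono {d e : ℤ} (h : d ≤ e) : EFilt d ≤ EFilt e :=
  Finsupp.supported_mono fun _ hS => le_trans hS h

lemma bra_mem_EFilt {d : ℤ} {S : Finset ℕ} (h : ((∑ s ∈ S, s : ℕ) : ℤ) ≤ d) : bra S ∈ EFilt d :=
  Finsupp.single_mem_supported K _ h

lemma map_mem_EFilt (f : E →ₗ[K] E) {d e : ℤ}
    (h : ∀ S : Finset ℕ, ((∑ s ∈ S, s : ℕ) : ℤ) ≤ d → f (bra S) ∈ EFilt e) {w : E}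
    (hw : w ∈ EFilt d) : f w ∈ EFilt e := by
  have : EFilt d ≤ (EFilt e).comap f := by
    rw [EFilt, Finsupp.supported_eq_span_single, Submodule.span_le]
    rintro _ ⟨S, hS, rfl⟩
    exact h S hS
  exact this hw

lemma create_mem_EFilt (k : ℕ) {d : ℤ} {w : E} (hw : w ∈ EFilt d) :
    create k w ∈ EFilt (d + k) := by
  refine map_mem_EFilt _ (fun S hS => ?_) hw
  rw [create_bra]
  split_ifs with hk
  · exact zero_mem _
  · refine Submodule.smul_mem _ _ (bra_mem_EFilt ?_)
    rw [Finset.sum_insert hk]; push_cast at hS ⊢; linarith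

lemma annihilate_mem_EFilt (k : ℕ) {d : ℤ} {w : E} (hw : w ∈ EFilt d) :
    annihilate k w ∈ EFilt (d - k) := by
  refine map_mem_EFilt _ (fun S hS => ?_) hw
  rw [annihilate_bra]
  split_ifs with hk
  · refine Submodule.smul_mem _ _ (bra_mem_EFilt ?_)
    rw [← Finset.add_sum_erase S (fun s => s) hk] at hS; push_cast at hS ⊢; linarith
  · exact zero_mem _

lemma phi_mem_EFilt (n : ℤ) {d : ℤ} {w : E} (hw : w ∈ EFilt d) : phi n w ∈ EFilt (d - n) := by
  rcases lt_trichotomy n 0 with hn | rfl | hn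
  · have := create_mem_EFilt n.natAbs hw
    have h : d + (n.natAbs : ℤ) = d - n := by omega
    rw [h] at this
    simpa [phi, hn] using this
  · have h1 := create_mem_EFilt 0 hw
    have h2 := annihilate_mem_EFilt 0 hw
    simp only [Nat.cast_zero, add_zero, sub_zero] at h1 h2
    simpa [phi] using add_mem h1 h2
  · have := annihilate_mem_EFilt n.natAbs hw
    have h : d - (n.natAbs : ℤ) = d - n := by omega
    rw [h] at this
    have h1 : ¬ n < 0 := by omega
    have h2 : n ≠ 0 := by omega
    simpa only [phi, h1, h2, if_false, LinearMap.smul_apply] using Submodule.smul_mem _ _ this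

lemma phi_eq_zero {d n : ℤ} (h : d < n) {w : E} (hw : w ∈ EFilt d) : phi n w = 0 :=
  EFilt_neg (by omega) (phi_mem_EFilt n hw)

/-! ### The deformed operators on `𝓔` -/

/-- The coefficient of `φ_m` in `φ^{(β)}_n`, i.e. the coefficient of `z^n` in `(z + β/2)^m` if
`m, n ≥ 0`, and in `(z⁻¹ / (1 + (β/2) z⁻¹))^{-m}` if `m, n < 0`. -/
def phiBetaCoeff : ℤ → ℤ → K
  | .ofNat n, .ofNat m =>
      ((Polynomial.X + Polynomial.C (beta / 2)) ^ m : Polynomial K).coeff n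
  | .negSucc n, .negSucc m =>
      PowerSeries.coeff (n + 1)
        ((PowerSeries.X * (1 + PowerSeries.C (beta / 2) * PowerSeries.X)⁻¹ : PowerSeries K)
          ^ (m + 1))
  | _, _ => 0

lemma phiBetaCoeff_eq_zero {n m : ℤ} (h : m < n) : phiBetaCoeff n m = 0 := by
  rcases n with n | n <;> rcases m with m | m
  · simp only [phiBetaCoeff]
    refine Polynomial.coeff_eq_zero_of_natDegree_lt ?_
    rw [Polynomial.natDegree_pow_X_add_C]
    simpa using h
  · rfl
  · rfl
  · simp only [phiBetaCoeff]
    rw [mul_pow, PowerSeries.coeff_X_pow_mul', if_neg]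
    omega

/-- The right action of `φ^{(β)}_n` on `𝓔`; the sum is locally finite. -/
def phiBeta (n : ℤ) (w : E) : E := ∑ᶠ m : ℤ, phiBetaCoeff n m • phi m w

lemma phiBeta_finite (n : ℤ) (w : E) :
    (Function.support fun m : ℤ => phiBetaCoeff n m • phi m w).Finite := by
  obtain ⟨d, hd⟩ := exists_mem_EFilt w
  refine (Set.finite_Icc n d).subset fun m hm => ?_
  rw [Function.mem_support] at hm
  constructor
  · by_contra h
    exact hm (by rw [phiBetaCoeff_eq_zero (by omega), zero_smul])
  · by_contra h
    exact hm (by rw [phi_eq_zero (by omega) hd, smul_zero])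

/-- The right action on `𝓔` of the Heisenberg generator
`b_m = (1/4) ∑_i (-1)^i φ_{-i-m} φ_i` (for odd `m`, where the sum is locally finite). -/
def heis (m : ℤ) (w : E) : E :=
  (1 / 4 : K) • ∑ᶠ i : ℤ, ((-1 : K) ^ i) • phi i (phi (-i - m) w)

lemma phi_phi_eq_zero {m i d : ℤ} (hm : m ≠ 0) {w : E} (hw : w ∈ EFilt d)
    (h : d < i ∨ d < -i - m) : phi i (phi (-i - m) w) = 0 := by
  rcases h with h | h
  · have := phi_anticomm (-i - m) i w
    rw [if_neg (by omega), phi_eq_zero h hw, map_zero, add_zero] at this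
    exact this
  · rw [phi_eq_zero h hw, map_zero]

lemma heis_finite {m : ℤ} (hm : m ≠ 0) (w : E) :
    (Function.support fun i : ℤ => ((-1 : K) ^ i) • phi i (phi (-i - m) w)).Finite := by
  obtain ⟨d, hd⟩ := exists_mem_EFilt w
  refine (Set.finite_Icc (-m - d) d).subset fun i hi => ?_
  rw [Function.mem_support] at hi
  by_contra h
  rw [Set.mem_Icc] at h
  exact hi (by rw [phi_phi_eq_zero hm hd (by omega), smul_zero])

lemma heis_mem_EFilt (m : ℤ) {d : ℤ} {w : E} (hw : w ∈ EFilt d) : heis m w ∈ EFilt (d + m) := by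
  refine Submodule.smul_mem _ _ (finsum_induction (· ∈ EFilt (d + m)) (zero_mem _)
    (fun _ _ => add_mem) fun i => Submodule.smul_mem _ _ ?_)
  have := phi_mem_EFilt i (phi_mem_EFilt (-i - m) hw)
  have h : d - (-i - m) - i = d + m := by ring
  rwa [h] at this

/-- The odd polynomial `((X - β/2)^m - (-X - β/2)^m) / 2`. -/
def heisBetaPoly (m : ℕ) : Polynomial K :=
  Polynomial.C (1 / 2) * ((Polynomial.X - Polynomial.C (beta / 2)) ^ m
    - (-Polynomial.X - Polynomial.C (beta / 2)) ^ m)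

lemma heisBetaPoly_coeff_even (m : ℕ) {k : ℕ} (hk : Even k) : (heisBetaPoly m).coeff k = 0 := by
  have h : (heisBetaPoly m).comp (Polynomial.C (-1) * Polynomial.X) = -heisBetaPoly m := by
    simp only [heisBetaPoly, Polynomial.mul_comp, Polynomial.sub_comp, Polynomial.pow_comp,
      Polynomial.C_comp, Polynomial.X_comp, Polynomial.neg_comp, Polynomial.C_neg,
      Polynomial.C_1, neg_mul, one_mul, neg_neg]
    ring
  have h2 := congrArg (fun q => Polynomial.coeff q k) h
  simp only [Polynomial.comp_C_mul_X_coeff, Polynomial.coeff_neg, hk.neg_one_pow, mul_one] at h2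
  have h3 : (2 : K) * (heisBetaPoly m).coeff k = 0 := by linear_combination h2
  exact (mul_eq_zero.1 h3).resolve_left two_ne_zero

/-- The right action of `b^{(β)}_m`, `m ≥ 0`: replace `X^k` by `b_k` in `heisBetaPoly m`. -/
def heisBeta (m : ℕ) (w : E) : E := (heisBetaPoly m).sum fun k c => c • heis k w

/-- The right action of `Θ = 2 ∑_{n odd} (β/2)^n b_{-n} / n`; the sum is locally finite. -/
def Theta (w : E) : E :=
  ∑ᶠ j : ℕ, (2 * (beta / 2) ^ (2 * j + 1) / (2 * j + 1 : ℕ) : K) • heis (-(2 * j + 1 : ℕ)) w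

lemma Theta_finite (w : E) : (Function.support fun j : ℕ =>
    (2 * (beta / 2) ^ (2 * j + 1) / (2 * j + 1 : ℕ) : K) • heis (-(2 * j + 1 : ℕ)) w).Finite := by
  obtain ⟨d, hd⟩ := exists_mem_EFilt w
  refine (Set.finite_Iic d).subset fun j hj => ?_
  rw [Function.mem_support] at hj
  by_contra h
  rw [Set.mem_Iic] at h
  exact hj (by rw [EFilt_neg (by push_cast; omega) (heis_mem_EFilt (-(2 * j + 1 : ℕ)) hd),
    smul_zero])

lemma Theta_mem_EFilt {d : ℤ} {w : E} (hw : w ∈ EFilt d) : Theta w ∈ EFilt (d - 1) :=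
  finsum_induction (· ∈ EFilt (d - 1)) (zero_mem _) (fun _ _ => add_mem) fun j =>
    Submodule.smul_mem _ _ (EFilt_mono (by push_cast; omega)
      (heis_mem_EFilt (-(2 * j + 1 : ℕ)) hw))

lemma expTheta_finite (w : E) :
    (Function.support fun r : ℕ => ((r.factorial : K)⁻¹) • Theta^[r] w).Finite := by
  obtain ⟨d, hd⟩ := exists_mem_EFilt w
  have key : ∀ r : ℕ, Theta^[r] w ∈ EFilt (d - r) := by
    intro r
    induction r with
    | zero => simpa using hd
    | succ r ih =>
      rw [Function.iterate_succ_apply']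
      have := Theta_mem_EFilt ih
      push_cast
      rwa [sub_sub] at this
  refine (Set.finite_Iic d).subset fun r hr => ?_
  rw [Function.mem_support] at hr
  by_contra h
  rw [Set.mem_Iic] at h
  exact hr (by rw [EFilt_neg (by omega) (key r), smul_zero])

/-- The right action of `e^Θ`; the operator `Θ` is locally nilpotent. -/
def expTheta (w : E) : E := ∑ᶠ r : ℕ, ((r.factorial : K)⁻¹) • Theta^[r] w

/-- The space `𝓔[[p₁, p₂, …]]` of formal series with coefficients in `𝓔`. -/
abbrev EP : Type := (ℕ+ →₀ ℕ) → E

/-- The right action of `𝓗^{(β)} = 2 ∑_{n ≥ 1} (p_n / n) b^{(β)}_n` on `𝓔[[p]]`. -/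
def Hbeta (W : EP) : EP := fun α =>
  ∑ n ∈ α.support, (2 / ((n : ℕ) : K)) • heisBeta n (W (α - Finsupp.single n 1))

lemma heisBeta_zero (m : ℕ) : heisBeta m 0 = 0 := by
  simp [heisBeta, heis, Polynomial.sum]

lemma expHbeta_finite (w : E) (α : ℕ+ →₀ ℕ) : (Function.support fun r : ℕ =>
    ((r.factorial : K)⁻¹) • Hbeta^[r] (fun α => if α = 0 then w else 0) α).Finite := by
  have key : ∀ (r : ℕ) (α : ℕ+ →₀ ℕ), α.degree < r →
      Hbeta^[r] (fun α => if α = 0 then w else 0) α = 0 := by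
    intro r
    induction r with
    | zero => intro α h; omega
    | succ r ih =>
      intro α h
      rw [Function.iterate_succ_apply']
      refine Finset.sum_eq_zero fun n hn => ?_
      have h1 : Finsupp.single n 1 ≤ α := by
        rw [Finsupp.single_le_iff]
        have := Finsupp.mem_support_iff.1 hn
        omega
      have h2 : (α - Finsupp.single n 1).degree + 1 = α.degree := by
        conv_rhs => rw [← tsub_add_cancel_of_le h1, map_add, Finsupp.degree_single]
      rw [ih _ (by omega), heisBeta_zero, smul_zero]
  refine (Set.finite_Iic α.degree).subset fun r hr => ?_
  rw [Function.mem_support] at hr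
  by_contra h
  rw [Set.mem_Iic] at h
  exact hr (by rw [key r α (by omega), smul_zero])

/-- The right action of `e^{𝓗^{(β)}}` on `𝓔[[p]]`; each coefficient is a finite sum. -/
def expHbeta (W : EP) : EP := fun α => ∑ᶠ r : ℕ, ((r.factorial : K)⁻¹) • Hbeta^[r] W α

/-- The embedding `𝓔 ⊆ 𝓔[[p]]` as constant series. -/
def constEP (w : E) : EP := fun α => if α = 0 then w else 0

/-- The vacuum expectation value `⟨0|e^{𝓗^{(β)}} φ^{(β)}_n e^Θ φ^{(β)}_0 e^Θ|0⟩ ∈ k[[p₁, p₂, …]]`;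
operators act on the right, coefficientwise on `𝓔[[p]]`. -/
def vev (n : ℤ) : MvPowerSeries ℕ+ K := fun α =>
  pairVac (expTheta (phiBeta 0 (expTheta (phiBeta n (expHbeta (constEP vac) α)))))

/-! ### Symmetric functions in `x₀, x₁, x₂, …` -/

open scoped Classical in
/-- The power sum `p_n(x) = ∑_i x_i^n`. -/
def powerSum (n : ℕ+) : MvPowerSeries ℕ K := fun d =>
  if ∃ i : ℕ, d = Finsupp.single i (n : ℕ) then 1 else 0

lemma hasSubst_powerSum : MvPowerSeries.HasSubst powerSum where
  const_coeff n := by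
    have h : MvPowerSeries.constantCoeff (powerSum n) = 0 := by
      rw [← MvPowerSeries.coeff_zero_eq_constantCoeff_apply]
      refine if_neg ?_
      rintro ⟨i, hi⟩
      exact n.pos.ne' (Finsupp.single_eq_zero.1 hi.symm)
    rw [h]
    exact IsNilpotent.zero
  coeff_zero d := by
    refine (Set.finite_Iic (d.degree.succPNat)).subset fun n hn => ?_
    have h : ∃ i : ℕ, d = Finsupp.single i (n : ℕ) := by
      by_contra h
      exact hn (if_neg h)
    obtain ⟨i, rfl⟩ := h
    rw [Set.mem_Iic, ← PNat.coe_le_coe]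
    simp

/-- The vacuum expectation value after the identification `p_n ↦ p_n(x)`. -/
def vevX (n : ℤ) : MvPowerSeries ℕ K := MvPowerSeries.subst powerSum (vev n)

/-- `x ⊕ y = x + y + β x y`. -/
def oplus {R : Type*} [CommRing R] [Algebra K R] (x y : R) : R := x + y + algebraMap K R beta * x * y

/-- `x ⊖ y = (x - y) / (1 + β y)`. -/
def ominus {R : Type*} [Field R] [Algebra K R] (x y : R) : R :=
  (x - y) / (1 + algebraMap K R beta * y)

/-- The field of rational functions in `x_0, …, x_N`. -/
abbrev RatF (N : ℕ) : Type := FractionRing (MvPolynomial (Fin (N + 1)) K)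

/-- The variable `x_i` in the field of rational functions. -/
def xvar {N : ℕ} (i : Fin (N + 1)) : RatF N := algebraMap _ _ (MvPolynomial.X i : MvPolynomial _ K)

/-- The one-row `K`-theoretic `Q`-polynomial in the `N + 1` variables `x_0, …, x_N`:
`(1/N!) ∑_w w[ (x_0 ⊕ x_0) x_0^{n-1} ∏_{j ≥ 1} (x_0 ⊕ x_j) / (x_0 ⊖ x_j) ]`, for `n ≥ 1`,
where `w` runs over the permutations of the variables. -/
def GQfin (n N : ℕ) : RatF N :=
  ((N.factorial : RatF N)⁻¹) * ∑ w : Equiv.Perm (Fin (N + 1)),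
    oplus (xvar (w 0)) (xvar (w 0)) * xvar (w 0) ^ (n - 1) *
      ∏ j : Fin N, oplus (xvar (w 0)) (xvar (w j.succ)) / ominus (xvar (w 0)) (xvar (w j.succ))

/-- `f` is the limit of the one-row `K`-theoretic `Q`-polynomials as the number of variables tends
to infinity: for every `N`, the series `f(x_0, …, x_N, 0, 0, …)` is the polynomial `GQfin n N`. -/
def IsGQLimit (n : ℕ) (f : MvPowerSeries ℕ K) : Prop :=
  ∀ N : ℕ, ∃ p : MvPolynomial (Fin (N + 1)) K, algebraMap _ (RatF N) p = GQfin n N ∧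
    ∀ d : Fin (N + 1) →₀ ℕ, MvPowerSeries.coeff (d.mapDomain Fin.val) f = p.coeff d

/-! ### The generating function -/

/-- Laurent series in `z⁻¹` over `k`; the variable of `LaurentSeries` is `z⁻¹`. -/
abbrev L : Type := LaurentSeries K

/-- The element `z⁻¹`. -/
def zinv : L := HahnSeries.single 1 1

/-- The element `z`. -/
def z : L := HahnSeries.single (-1) 1

/-- `β` as a constant Laurent series. -/
def betaL : L := HahnSeries.C beta

/-- `x̄_i = -x_i / (1 + b x_i)`. -/
def xbar {F : Type*} [Field F] (b : F) (i : ℕ) : MvPowerSeries ℕ F :=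
  -MvPowerSeries.X i * (1 + MvPowerSeries.C b * MvPowerSeries.X i)⁻¹

/-- The factor `(1 + (t + b) x_i) / (1 + (t + b) x̄_i)`, a power series with constant term `1`. -/
def genFactor {F : Type*} [Field F] (b t : F) (i : ℕ) : MvPowerSeries ℕ F :=
  (1 + MvPowerSeries.C (t + b) * MvPowerSeries.X i) *
    (1 + MvPowerSeries.C (t + b) * xbar b i)⁻¹

/-- The infinite product `∏_i f_i` of series with `f_i ≡ 1` modulo `x_i`: the coefficient of a
monomial is its coefficient in any sufficiently long finite product
(see `coeff_infProd_genFactor`). -/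
def infProd {F : Type*} [Field F] (f : ℕ → MvPowerSeries ℕ F) : MvPowerSeries ℕ F := fun d =>
  MvPowerSeries.coeff d (∏ i ∈ Finset.range (d.support.sup fun i => i + 1), f i)

lemma X_dvd_quotient_sub_one {F : Type*} [Field F] (i : ℕ) (c : F) {y : MvPowerSeries ℕ F}
    (hy : MvPowerSeries.X i ∣ y) :
    MvPowerSeries.X i ∣ (1 + MvPowerSeries.C c * MvPowerSeries.X i) *
      (1 + MvPowerSeries.C c * y)⁻¹ - 1 := by
  have h0 : MvPowerSeries.constantCoeff y = 0 := by
    obtain ⟨u, rfl⟩ := hy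
    simp
  have h : MvPowerSeries.constantCoeff (1 + MvPowerSeries.C c * y) ≠ 0 := by simp [h0]
  have h2 := MvPowerSeries.mul_inv_cancel _ h
  have h1 : (1 + MvPowerSeries.C c * MvPowerSeries.X i) * (1 + MvPowerSeries.C c * y)⁻¹ - 1 =
      MvPowerSeries.C c * (MvPowerSeries.X i - y) * (1 + MvPowerSeries.C c * y)⁻¹ := by
    linear_combination h2
  rw [h1]
  exact Dvd.dvd.mul_right (Dvd.dvd.mul_left (dvd_sub dvd_rfl hy) _) _

lemma X_dvd_genFactor_sub_one {F : Type*} [Field F] (b t : F) (i : ℕ) :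
    MvPowerSeries.X i ∣ genFactor b t i - 1 :=
  X_dvd_quotient_sub_one i (t + b) (Dvd.dvd.mul_right (dvd_neg.2 dvd_rfl) _)

lemma coeff_infProd_genFactor {F : Type*} [Field F] (b t : F) (d : ℕ →₀ ℕ) {N : ℕ}
    (hN : ∀ i ∈ d.support, i < N) :
    MvPowerSeries.coeff d (infProd (genFactor b t)) =
      MvPowerSeries.coeff d (∏ i ∈ Finset.range N, genFactor b t i) := by
  have hle : (d.support.sup fun i => i + 1) ≤ N := Finset.sup_le fun i hi => hN i hi
  have hsup : ∀ i ∈ d.support, i < d.support.sup fun i => i + 1 := fun i hi =>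
    Finset.le_sup (f := fun i => i + 1) hi
  change MvPowerSeries.coeff d _ = _
  clear hN
  induction N, hle using Nat.le_induction with
  | base => rfl
  | succ M hM ih =>
    rw [ih, Finset.prod_range_succ]
    have h1 : MvPowerSeries.X M ∣
        (∏ i ∈ Finset.range M, genFactor b t i) * (genFactor b t M - 1) :=
      Dvd.dvd.mul_left (X_dvd_genFactor_sub_one b t M) _
    have h2 : d M = 0 := by
      by_contra h
      exact (lt_irrefl M) ((hsup M (Finsupp.mem_support_iff.2 h)).trans_le hM)
    have h3 := MvPowerSeries.X_dvd_iff.1 h1 d h2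
    rw [mul_sub, mul_one, map_sub, sub_eq_zero] at h3
    exact h3.symm

/-- `(1 + β z⁻¹)⁻¹ ∏_i (1 + (z + β) x_i) / (1 + (z + β) x̄_i)` in `k((z⁻¹))[[x_0, x_1, …]]`. -/
def genGQ : MvPowerSeries ℕ L :=
  MvPowerSeries.C ((1 + betaL * zinv)⁻¹) * infProd (genFactor betaL z)

/-- The coefficient of `z^n` in an element of `k((z⁻¹))[[x_0, x_1, …]]`. -/
def zCoeff (n : ℤ) (G : MvPowerSeries ℕ L) : MvPowerSeries ℕ K := fun d =>
  (MvPowerSeries.coeff d G).coeff (-n)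

/-- `f = GQ_n(x)`: for `n ≥ 1` this is the `K`-theoretic `Q`-function of the one-row partition
`(n)`; for `n ≤ 0` it is given by the generating function. -/
def IsGQ (n : ℤ) (f : MvPowerSeries ℕ K) : Prop :=
  if 0 < n then IsGQLimit n.toNat f else f = zCoeff n genGQ

end

end KQ

namespace KQ

noncomputable section

/-! ### Commutation relations of the Heisenberg generators -/

/-! Write γ = β/2 and let κ(w) = ⟨w|e^Θ φ^{(β)}_0 e^Θ|0⟩ (`kappa`). The proof rests on κ being a
joint eigenfunctional of the positive odd Heisenberg generators: κ(⟨w|b_m) = γ^m κ(w)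
(`kappa_heis`). Moving b_m to the right past an e^Θ produces the scalar γ^m, since [b_m, b_{-m}] =
m/2 (`expTheta_heis`). The commutator with φ^{(β)}_0 cancels the scalar from the second e^Θ, and
b_m|0⟩ = 0.

Put S(w) = ∑ κ(⟨w|φ_n) z^n. As [b_m, φ_n] = φ_{n-m}, letting b_m act on w multiplies S(w) by z^m +
γ^m. Passing from φ_n to φ^{(β)}_n is the substitution z ↦ z + γ, so on the resulting series
`genVev` the multiplier becomes (z + γ)^m + γ^m. The polynomial P defining b^{(β)}_n is odd, hence
2b^{(β)}_n acts by 2P(z + γ) + 2P(γ) = z^n - (-z-β)^n - (-β)^n = ν_n. Thus e^{𝓗} multiplies the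
series by exp(∑ ν_n p_n / n). What remains is the vacuum value (1 + β/z)^{-1} (`genVev_vac`), which
comes from conjugating fermion series by e^Θ: their index series is multiplied by (1 - γX)/(1 + γX).

For p_n = p_n(x) the exponential is ∏_i (1 + βx_i)(1 + (z+β)x_i)/(1 - z x_i), which is the product
in the generating function (`genFactor_eq`). Instead of manipulating logarithms, both sides are
shown to satisfy the recursion obtained from the Euler operator ∑ x_i ∂_i (`substCoeff_rec`,
`prodCoeff_rec`). This yields `vevX_eq` for every n.

For n ≥ 1 the symmetrised sum must still be matched. It equals ∑_i r_i x_i^n, where the r_i come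
from the partial fractions (z+β) ∑_i r_i x_i/(1 - x_i z) = ∏_i (⋯) - 1 (`partial_fractions`). This
is an expansion at z = 0, whereas the generating function is expanded at z = ∞. The two agree
because each x-monomial has a coefficient polynomial in z, and, after subtracting the constant
monomial 1, divisible by z + β (`exists_quotient`). The leftover (1 + β/z)^{-1} has no positive
powers of z. -/

lemma neg_one_zpow_mul_natAbs (i : ℤ) : ((-1 : K) ^ i) * (-1) ^ i.natAbs = 1 := by
  rcases Int.natAbs_eq i with h | h
  · generalize i.natAbs = k at h
    subst h
    rw [zpow_natCast, ← mul_pow]; simp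
  · generalize i.natAbs = k at h
    subst h
    rw [zpow_neg, zpow_natCast]
    exact inv_mul_cancel₀ (pow_ne_zero _ (by norm_num))

lemma neg_one_zpow_mul_self (i : ℤ) : ((-1 : K) ^ i) * (-1) ^ i = 1 := by
  rw [← mul_zpow]; simp

lemma neg_one_natAbs (i : ℤ) : (-1 : K) ^ i.natAbs = (-1) ^ i := by
  have h1 := neg_one_zpow_mul_natAbs i
  have h2 := neg_one_zpow_mul_self i
  have h3 : (-1 : K) ^ i ≠ 0 := zpow_ne_zero _ (by norm_num)
  exact mul_left_cancel₀ h3 (h1.trans h2.symm)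

lemma neg_one_zpow_odd {m : ℤ} (hm : Odd m) : (-1 : K) ^ m = -1 := hm.neg_one_zpow

lemma odd_ne_zero {m : ℤ} (hm : Odd m) : m ≠ 0 := by
  rintro rfl
  exact absurd hm (by decide)

/-- The right action of `b_m`, `m` odd, as a linear map. -/
def heisLin (m : ℤ) (hm : Odd m) : E →ₗ[K] E where
  toFun := heis m
  map_add' u w := by
    have hm := odd_ne_zero hm
    simp only [heis]
    rw [← smul_add, ← finsum_add_distrib (heis_finite hm u) (heis_finite hm w)]
    simp only [map_add, smul_add]
  map_smul' a w := by
    have hm := odd_ne_zero hm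
    simp only [heis, RingHom.id_apply]
    rw [smul_comm a, smul_finsum' a (heis_finite hm w)]
    simp only [map_smul, smul_comm a]

@[simp] lemma heisLin_apply {m : ℤ} (hm : Odd m) (w : E) : heisLin m hm w = heis m w := rfl

/-- Each summand of b_m contains two fermions, so φ_j has a nonzero anticommutator with two of the
summands. The resulting terms have equal sign because m is odd, and 2 + 2 cancels the factor 1/4. -/
lemma phi_heis {m : ℤ} (hm : Odd m) (j : ℤ) (w : E) :
    phi j (heis m w) = heis m (phi j w) + phi (j - m) w := by
  have hm0 := odd_ne_zero hm
  have e1 : phi j (heis m w) =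
      (1 / 4 : K) • ∑ᶠ i : ℤ, phi j (((-1 : K) ^ i) • phi i (phi (-i - m) w)) := by
    rw [heis, map_smul, map_finsum _ (heis_finite hm0 w)]
  have f1 : (Function.support fun i : ℤ =>
      phi j (((-1 : K) ^ i) • phi i (phi (-i - m) w))).Finite :=
    (heis_finite hm0 w).subset fun i hi h => hi (by
      change phi j _ = 0
      simp only at h
      rw [h, map_zero])
  -- The commutator of a product is a difference of anticommutators; φ_i contributes at i = -j and
  -- φ_{-i-m} at i = j - m.
  have key : ∀ i : ℤ, phi j (((-1 : K) ^ i) • phi i (phi (-i - m) w)) -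
      ((-1 : K) ^ i) • phi i (phi (-i - m) (phi j w)) =
      (if i = -j then (2 : K) • phi (j - m) w else 0) +
        if i = j - m then (2 : K) • phi (j - m) w else 0 := by
    intro i
    have a1 := phi_anticomm i j (phi (-i - m) w)
    have a2 := congrArg (phi i) (phi_anticomm (-i - m) j w)
    rw [map_add] at a2
    have h1 : (i + j = 0) ↔ (i = -j) := by omega
    have h2 : (-i - m + j = 0) ↔ (i = j - m) := by omega
    simp only [h1] at a1
    simp only [h2] at a2
    have a3 : phi j (phi i (phi (-i - m) w)) - phi i (phi (-i - m) (phi j w)) =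
        (if i = -j then (2 * (-1) ^ i.natAbs : K) • phi (-i - m) w else 0) -
          phi i (if i = j - m then (2 * (-1) ^ (-i - m).natAbs : K) • w else 0) := by
      rw [← a1, ← a2]; abel
    rw [map_smul, ← smul_sub, a3, smul_sub, sub_eq_add_neg]
    congr 1
    · split_ifs with h
      · rw [smul_smul, mul_left_comm, neg_one_zpow_mul_natAbs, mul_one, h, neg_neg]
      · simp
    · split_ifs with h
      · rw [map_smul, smul_smul, ← neg_smul, ← h]
        congr 1
        rw [neg_one_natAbs, sub_eq_add_neg, ← neg_add, zpow_neg, zpow_add₀ (by norm_num),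
          neg_one_zpow_odd hm]
        have := zpow_ne_zero i (show (-1 : K) ≠ 0 by norm_num)
        field_simp
      · simp
  rw [← sub_eq_iff_eq_add', e1, heis, ← smul_sub,
    ← finsum_sub_distrib f1 (heis_finite hm0 (phi j w)), finsum_congr key,
    finsum_add_distrib, finsum_eq_single _ (-j), finsum_eq_single _ (j - m)]
  · simp only [if_true]
    rw [← add_smul, smul_smul]; norm_num
  · intro i hi; rw [if_neg hi]
  · intro i hi; rw [if_neg hi]
  · exact (Set.finite_singleton (-j)).subset fun i hi => by
      by_contra h; exact hi (if_neg h)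
  · exact (Set.finite_singleton (j - m)).subset fun i hi => by
      by_contra h; exact hi (if_neg h)

/-- A linear operator commuting with all fermions is determined by its value on `⟨0|`. -/
lemma eq_smul_of_commute_phi (f : E →ₗ[K] E) (h : ∀ j w, phi j (f w) = f (phi j w)) {a : K}
    (hv : f vac = a • vac) (w : E) : f w = a • w := by
  suffices f = a • LinearMap.id by rw [this]; simp
  refine hom_ext fun S => ?_
  -- Adding the largest index means appending the last fermion of the word.
  induction S using Finset.induction_on_max with
  | empty => exact hv
  | insert k S hS ih => rw [← phi_bra hS, ← h, ih]; simp

lemma vac_mem_EFilt : vac ∈ EFilt 0 := bra_mem_EFilt (by simp)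

lemma heis_vac_of_neg {m : ℤ} (hm : m < 0) : heis m vac = 0 :=
  EFilt_neg (by simpa using hm) (heis_mem_EFilt m vac_mem_EFilt)

lemma heis_eq_sum {m d : ℤ} (hm : m ≠ 0) {w : E} (hw : w ∈ EFilt d) :
    heis m w = (1 / 4 : K) • ∑ i ∈ Finset.Icc (-m - d) d,
      ((-1 : K) ^ i) • phi i (phi (-i - m) w) := by
  rw [heis, finsum_eq_sum_of_support_subset]
  intro i hi
  rw [Function.mem_support] at hi
  by_contra h
  rw [Finset.coe_Icc, Set.mem_Icc] at h
  exact hi (by rw [phi_phi_eq_zero hm hw (by omega), smul_zero])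

/-- Since b_{-n} annihilates ⟨0|, commuting it through the quadratic expression b_m leaves only
words ⟨0|φ_a φ_{n-m-a}. They form two sums over shifted intervals, whose difference is the central
term. -/
lemma heis_neg_heis_vac {m n : ℤ} (hm : Odd m) (hn : Odd n) (hm0 : 0 < m) (hn0 : 0 < n) :
    heis (-n) (heis m vac) = (if m = n then (m / 2 : K) else 0) • vac := by
  have hnn : Odd (-n) := hn.neg
  have comm : ∀ i w, heis (-n) (phi i w) = phi i (heis (-n) w) - phi (i + n) w := by
    intro i w
    rw [phi_heis hnn, sub_neg_eq_add, add_sub_cancel_right]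
  set f : ℤ → E := fun a => phi (n - m - a) (phi a vac) with hf
  have f0 : ∀ a, 0 < a → f a = 0 := fun a ha => by simp [hf, phi_vac ha]
  have fanti : ∀ a, n ≠ m → f a = - f (n - m - a) := by
    intro a hnm
    have := phi_anticomm a (n - m - a) vac
    rw [if_neg (by omega)] at this
    simp only [hf, sub_sub_cancel]
    exact eq_neg_of_add_eq_zero_left this
  have fneg : ∀ a, n = m → a < 0 → f a = (2 * (-1) ^ a : K) • vac := by
    intro a hnm ha
    have := phi_anticomm a (n - m - a) vac
    rw [if_pos (by omega), phi_vac (n := n - m - a) (by omega), map_zero, add_zero,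
      neg_one_natAbs] at this
    exact this
  have sgn : ∀ i : ℤ, (-1 : K) ^ (-m - i) = - (-1 : K) ^ i := by
    intro i
    rw [show -m - i = -(m + i) by ring, zpow_neg, zpow_add₀ (by norm_num), neg_one_zpow_odd hm]
    have := neg_one_zpow_mul_self i
    rw [inv_eq_of_mul_eq_one_left]
    linear_combination this
  have sgn2 : ∀ i : ℤ, (-1 : K) ^ (n - m - i) = (-1 : K) ^ i := by
    intro i
    rw [show n - m - i = n + (-m - i) by ring, zpow_add₀ (by norm_num), sgn, neg_one_zpow_odd hn]
    ring
  -- The two fermions of a summand give one term each. The reflections a = -m-i and a = n-m-i index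
  -- both sums by the first fermion; the first changes the sign since m is odd, the second does not
  -- since m + n - 2m-type parities cancel for odd m and n.
  have e1 : heis (-n) (heis m vac) = (1 / 4 : K) • (∑ a ∈ Finset.Icc (-m) 0, (-1 : K) ^ a • f a -
      ∑ a ∈ Finset.Icc (n - m) n, (-1 : K) ^ a • f a) := by
    rw [heis_eq_sum hm0.ne' vac_mem_EFilt, ← heisLin_apply hnn, map_smul, map_sum, sub_zero]
    congr 1
    have e2 : ∑ a ∈ Finset.Icc (-m) 0, (-1 : K) ^ a • f a =
        - ∑ i ∈ Finset.Icc (-m) 0, (-1 : K) ^ i • f (-m - i) := by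
      rw [← Finset.sum_neg_distrib]
      refine Finset.sum_nbij' (fun a => -m - a) (fun a => -m - a) ?_ ?_ ?_ ?_ ?_
      · intro a; simp only [Finset.mem_Icc]; omega
      · intro a; simp only [Finset.mem_Icc]; omega
      · intro a _; ring
      · intro a _; ring
      · intro a _; rw [sgn, sub_sub_cancel, neg_smul, neg_neg]
    have e3 : ∑ a ∈ Finset.Icc (n - m) n, (-1 : K) ^ a • f a =
        ∑ i ∈ Finset.Icc (-m) 0, (-1 : K) ^ i • f (n - m - i) := by
      refine Finset.sum_nbij' (fun a => n - m - a) (fun a => n - m - a) ?_ ?_ ?_ ?_ ?_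
      · intro a; simp only [Finset.mem_Icc]; omega
      · intro a; simp only [Finset.mem_Icc]; omega
      · intro a _; ring
      · intro a _; ring
      · intro a _; rw [sgn2, sub_sub_cancel]
    rw [e2, e3, ← Finset.sum_neg_distrib, ← Finset.sum_sub_distrib]
    refine Finset.sum_congr rfl fun i _ => ?_
    rw [map_smul, heisLin_apply, comm, comm, heis_vac_of_neg (by omega), map_zero, zero_sub,
      map_neg, ← smul_neg, ← smul_sub]
    congr 1
    simp only [hf]
    rw [show n - m - (-m - i) = i + n by ring, show n - m - (n - m - i) = i by ring,
      show -i - m + n = n - m - i by ring, show -i - m = -m - i by ring]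
    abel
  rw [e1]
  -- For n = m the common term `f 0` cancels and the n terms with a < 0 remain, each equal to 2⟨0|,
  -- so the total is 2n/4. For n ≠ m antisymmetry confines the support of `f` to n - m ≤ a ≤ 0, and
  -- the two sums coincide.
  by_cases hnm : n = m
  · subst hnm
    rw [if_pos rfl]
    have e4 : ∑ a ∈ Finset.Icc (n - n) n, (-1 : K) ^ a • f a = f 0 := by
      rw [Finset.sum_eq_single_of_mem 0]
      · simp
      · rw [Finset.mem_Icc]; omega
      · intro a ha ha0
        rw [Finset.mem_Icc] at ha
        rw [f0 a (by omega), smul_zero]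
    have e5 : ∑ a ∈ Finset.Icc (-n) 0, (-1 : K) ^ a • f a =
        (∑ a ∈ Finset.Ico (-n) 0, (-1 : K) ^ a • f a) + f 0 := by
      rw [← Finset.Ico_insert_right (by omega), Finset.sum_insert (by simp)]
      simp [add_comm]
    have e6 : ∑ a ∈ Finset.Ico (-n) 0, (-1 : K) ^ a • f a =
        ∑ a ∈ Finset.Ico (-n) 0, (2 : K) • vac := by
      refine Finset.sum_congr rfl fun a ha => ?_
      rw [Finset.mem_Ico] at ha
      rw [fneg a rfl ha.2, smul_smul, mul_left_comm, neg_one_zpow_mul_self, mul_one]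
    rw [e4, e5, add_sub_cancel_right, e6, Finset.sum_const, Int.card_Ico, zero_sub, neg_neg,
      ← Nat.cast_smul_eq_nsmul K, smul_smul, smul_smul]
    congr 1
    have : ((n.toNat : ℕ) : K) = (n : K) := by
      rw [← Int.cast_natCast, Int.toNat_of_nonneg hn0.le]
    rw [this]
    ring
  · rw [if_neg (Ne.symm hnm), zero_smul]
    have fz : ∀ a, a < n - m → f a = 0 := fun a ha => by
      rw [fanti a hnm, f0 _ (by omega), neg_zero]
    have e7 : ∑ a ∈ Finset.Icc (-m) 0, (-1 : K) ^ a • f a =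
        ∑ a ∈ Finset.Icc (-m) n, (-1 : K) ^ a • f a := by
      refine Finset.sum_subset (Finset.Icc_subset_Icc_right hn0.le) fun a ha ha' => ?_
      rw [Finset.mem_Icc] at ha ha'
      rw [f0 a (by omega), smul_zero]
    have e8 : ∑ a ∈ Finset.Icc (n - m) n, (-1 : K) ^ a • f a =
        ∑ a ∈ Finset.Icc (-m) n, (-1 : K) ^ a • f a := by
      refine Finset.sum_subset (Finset.Icc_subset_Icc_left (by omega)) fun a ha ha' => ?_
      rw [Finset.mem_Icc] at ha ha'
      rw [fz a (by omega), smul_zero]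
    rw [e7, e8, sub_self, smul_zero]

/-- The relation `[b_m, b_{-n}] = (m/2) δ_{m,n}` for odd `m, n > 0`. -/
lemma heis_neg_heis {m n : ℤ} (hm : Odd m) (hn : Odd n) (hm0 : 0 < m) (hn0 : 0 < n) (w : E) :
    heis (-n) (heis m w) = heis m (heis (-n) w) + (if m = n then (m / 2 : K) else 0) • w := by
  have hnn : Odd (-n) := hn.neg
  rw [← sub_eq_iff_eq_add']
  -- By the Jacobi identity the commutator [b_m, b_{-n}] commutes with every fermion: both orders
  -- shift the index by n - m. It is therefore a scalar, read off on ⟨0|.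
  refine eq_smul_of_commute_phi (heisLin (-n) hnn ∘ₗ heisLin m hm - heisLin m hm ∘ₗ heisLin (-n) hnn)
    (fun j u => ?_) ?_ w
  · have c1 := phi_heis hnn
    have c2 := phi_heis hm
    have a1 : ∀ x y, heis (-n) (x + y) = heis (-n) x + heis (-n) y := (heisLin (-n) hnn).map_add
    have a2 : ∀ x y, heis m (x + y) = heis m x + heis m y := (heisLin m hm).map_add
    simp only [LinearMap.sub_apply, LinearMap.comp_apply, heisLin_apply, map_sub]
    rw [c1, c2, c2, c2, c1, c1, a1, a2, show j - -n - m = j - m - -n by ring]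
    abel
  · have := heis_neg_heis_vac hm hn hm0 hn0
    have z : heis m 0 = 0 := (heisLin m hm).map_zero
    simp only [LinearMap.sub_apply, LinearMap.comp_apply, heisLin_apply]
    rw [this, heis_vac_of_neg (m := -n) (by omega), z, sub_zero]

/-- `b_m|0⟩ = 0` for `m > 0`. -/
lemma pairVac_heis {m : ℤ} (hm0 : 0 < m) (w : E) : pairVac (heis m w) = 0 := by
  obtain ⟨d, hd⟩ := exists_mem_EFilt w
  rw [heis_eq_sum hm0.ne' hd, map_smul, map_sum, Finset.sum_eq_zero, smul_zero]
  intro i _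
  rw [map_smul]
  rcases lt_or_ge i 0 with hi | hi
  · rw [pairVac_phi_neg hi, smul_zero]
  · have := phi_anticomm (-i - m) i w
    rw [if_neg (by omega)] at this
    rw [eq_neg_of_add_eq_zero_left this, map_neg, pairVac_phi_neg (by omega), neg_zero, smul_zero]

local notation "γ" => (beta / 2 : K)

/-! ### Generating series of fermions and their conjugation by `e^Θ` -/

lemma phiSer_finite (j : ℤ) (f : PowerSeries K) (w : E) : (Function.support fun i : ℕ =>
    PowerSeries.coeff i f • phi (j + i) w).Finite := by
  obtain ⟨d, hd⟩ := exists_mem_EFilt w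
  refine (Set.finite_Iic (d - j).toNat).subset fun i hi => ?_
  rw [Function.mem_support] at hi
  by_contra h
  rw [Set.mem_Iic] at h
  exact hi (by rw [phi_eq_zero (by omega) hd, smul_zero])

/-- The right action of `∑_i f_i φ_{j+i}` for a formal series `f = ∑_i f_i X^i`. -/
def phiSer (j : ℤ) : PowerSeries K →ₗ[K] E →ₗ[K] E :=
  LinearMap.mk₂ K (fun f w => ∑ᶠ i : ℕ, PowerSeries.coeff i f • phi (j + i) w)
    (fun f g w => by
      rw [← finsum_add_distrib (phiSer_finite j f w) (phiSer_finite j g w)]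
      simp only [map_add, add_smul])
    (fun a f w => by
      rw [smul_finsum' a (phiSer_finite j f w)]
      simp only [map_smul, smul_eq_mul, mul_smul])
    (fun f w w' => by
      rw [← finsum_add_distrib (phiSer_finite j f w) (phiSer_finite j f w')]
      simp only [map_add, smul_add])
    (fun a f w => by
      rw [smul_finsum' a (phiSer_finite j f w)]
      simp only [map_smul, smul_comm a])

lemma phiSer_apply (j : ℤ) (f : PowerSeries K) (w : E) :
    phiSer j f w = ∑ᶠ i : ℕ, PowerSeries.coeff i f • phi (j + i) w := rfl

lemma phiSer_eq_sum {j d : ℤ} {N : ℕ} (h : d < j + N) (f : PowerSeries K) {w : E}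
    (hw : w ∈ EFilt d) :
    phiSer j f w = ∑ i ∈ Finset.range N, PowerSeries.coeff i f • phi (j + i) w := by
  rw [phiSer_apply, finsum_eq_sum_of_support_subset]
  intro i hi
  rw [Function.mem_support] at hi
  by_contra h'
  rw [Finset.coe_range, Set.mem_Iio] at h'
  exact hi (by rw [phi_eq_zero (by omega) hw, smul_zero])

lemma phiSer_eq_zero {j d : ℤ} {N : ℕ} (h : d < j + N) {f : PowerSeries K}
    (hf : PowerSeries.X ^ N ∣ f) {w : E} (hw : w ∈ EFilt d) : phiSer j f w = 0 := by
  rw [phiSer_eq_sum h f hw]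
  refine Finset.sum_eq_zero fun i hi => ?_
  rw [PowerSeries.X_pow_dvd_iff.1 hf i (Finset.mem_range.1 hi), zero_smul]

lemma phiSer_X_pow_mul (j : ℤ) (k : ℕ) (f : PowerSeries K) (w : E) :
    phiSer j (PowerSeries.X ^ k * f) w = phiSer (j + k) f w := by
  obtain ⟨d, hd⟩ := exists_mem_EFilt w
  obtain ⟨N, hN⟩ : ∃ N : ℕ, (d : ℤ) < j + k + N := ⟨(d - j - k + 1).toNat, by omega⟩
  rw [phiSer_eq_sum (N := k + N) (by push_cast; omega) _ hd, phiSer_eq_sum hN f hd,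
    Finset.sum_range_add, Finset.sum_eq_zero, zero_add]
  · refine Finset.sum_congr rfl fun i _ => ?_
    rw [add_comm k i, PowerSeries.coeff_X_pow_mul]
    push_cast
    rw [add_assoc, add_comm (k : ℤ)]
  · intro i hi
    rw [PowerSeries.X_pow_dvd_iff.1 (dvd_mul_right _ _) i (Finset.mem_range.1 hi), zero_smul]

lemma phiSer_one (j : ℤ) (w : E) : phiSer j 1 w = phi j w := by
  rw [phiSer_apply, finsum_eq_single _ 0]
  · simp
  · intro i hi
    rw [PowerSeries.coeff_one, if_neg hi, zero_smul]

lemma phiSer_X (j : ℤ) (w : E) : phiSer j PowerSeries.X w = phi (j + 1) w := by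
  have := phiSer_X_pow_mul j 1 1 w
  rwa [pow_one, mul_one, phiSer_one] at this

lemma phiSer_C (j : ℤ) (a : K) (f : PowerSeries K) (w : E) :
    phiSer j (PowerSeries.C a * f) w = a • phiSer j f w := by
  rw [← PowerSeries.smul_eq_C_mul, map_smul, LinearMap.smul_apply]

/-! ### The operators Θ and e^Θ acting on series of fermions -/

lemma odd_neg_two_mul (j : ℕ) : Odd (-((2 * j + 1 : ℕ) : ℤ)) :=
  Odd.neg ⟨j, by push_cast; ring⟩

/-- The right action of `Θ` as a linear map. -/
def thetaLin : E →ₗ[K] E where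
  toFun := Theta
  map_add' u w := by
    simp only [Theta]
    rw [← finsum_add_distrib (Theta_finite u) (Theta_finite w)]
    refine finsum_congr fun j => ?_
    rw [← smul_add, ← heisLin_apply (odd_neg_two_mul j), map_add]
    rfl
  map_smul' a w := by
    simp only [Theta, RingHom.id_apply]
    rw [smul_finsum' a (Theta_finite w)]
    refine finsum_congr fun j => ?_
    rw [smul_comm a, ← heisLin_apply (odd_neg_two_mul j), map_smul]
    rfl

@[simp] lemma thetaLin_apply (w : E) : thetaLin w = Theta w := rfl

/-- The series `2 ∑_{n odd} (β/2)^n X^n / n`. -/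
def thetaSer : PowerSeries K := PowerSeries.mk fun n => if Odd n then 2 * γ ^ n / n else 0

/-- The term b_{-n} of Θ raises the fermion index by n, so the commutator with φ_j collects the
coefficients of Θ into `thetaSer`. -/
lemma Theta_phi (j : ℤ) (w : E) : Theta (phi j w) = phi j (Theta w) - phiSer j thetaSer w := by
  have f1 : (Function.support fun k : ℕ => phi j
      ((2 * γ ^ (2 * k + 1) / (2 * k + 1 : ℕ) : K) • heis (-(2 * k + 1 : ℕ)) w)).Finite :=
    (Theta_finite w).subset fun i hi h => hi (by
      change phi j _ = 0
      simp only at h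
      rw [h, map_zero])
  have e1 : phiSer j thetaSer w = ∑ᶠ k : ℕ, (2 * γ ^ (2 * k + 1) / (2 * k + 1 : ℕ) : K) •
      phi (j + (2 * k + 1 : ℕ)) w := by
    rw [phiSer_apply, ← finsum_mem_univ, ← finsum_mem_inter_support, Set.univ_inter]
    have : Function.support (fun i : ℕ => PowerSeries.coeff i thetaSer • phi (j + i) w) =
        Set.range (fun k : ℕ => 2 * k + 1) ∩
          Function.support (fun i : ℕ => PowerSeries.coeff i thetaSer • phi (j + i) w) := by
      refine (Set.inter_eq_right.2 fun i hi => ?_).symm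
      by_contra h
      refine hi ?_
      have : ¬ Odd i := fun ⟨k, hk⟩ => h ⟨k, hk.symm⟩
      simp only [thetaSer, PowerSeries.coeff_mk, if_neg this, zero_smul]
    rw [this, finsum_mem_inter_support, finsum_mem_range (fun a b h => by simpa using h)]
    refine finsum_congr fun k => ?_
    simp only [thetaSer, PowerSeries.coeff_mk]
    rw [if_pos ⟨k, rfl⟩]
  have e2 : phi j (Theta w) = ∑ᶠ k : ℕ, phi j
      ((2 * γ ^ (2 * k + 1) / (2 * k + 1 : ℕ) : K) • heis (-(2 * k + 1 : ℕ)) w) := by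
    rw [Theta, map_finsum _ (Theta_finite w)]
  rw [eq_sub_iff_add_eq, e2, e1, Theta, ← finsum_add_distrib (Theta_finite _)]
  · refine finsum_congr fun k => ?_
    rw [map_smul, phi_heis (odd_neg_two_mul k), sub_neg_eq_add, smul_add]
  · obtain ⟨d, hd⟩ := exists_mem_EFilt w
    refine (Set.finite_Iic (d - j).toNat).subset fun i hi => ?_
    rw [Function.mem_support] at hi
    by_contra h
    rw [Set.mem_Iic] at h
    exact hi (by rw [phi_eq_zero (by push_cast; omega) hd, smul_zero])

lemma Theta_phiSer (j : ℤ) (f : PowerSeries K) (w : E) :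
    Theta (phiSer j f w) = phiSer j f (Theta w) + phiSer j (-thetaSer * f) w := by
  obtain ⟨d, hd⟩ := exists_mem_EFilt w
  obtain ⟨N, hN⟩ : ∃ N : ℕ, (d : ℤ) < j + N := ⟨(d - j + 1).toNat, by omega⟩
  have hd' : Theta w ∈ EFilt d := EFilt_mono (by omega) (Theta_mem_EFilt hd)
  -- On a vector of bounded degree only the first N coefficients of a series act, so `f` may be
  -- truncated to a polynomial.
  have hdvd : PowerSeries.X ^ N ∣ f - ∑ i ∈ Finset.range N,
      PowerSeries.C (PowerSeries.coeff i f) * PowerSeries.X ^ i := by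
    rw [PowerSeries.X_pow_dvd_iff]
    intro m hm
    simp [PowerSeries.coeff_C_mul, PowerSeries.coeff_X_pow, hm]
  have e1 : phiSer j (thetaSer * f) w = ∑ i ∈ Finset.range N,
      PowerSeries.coeff i f • phiSer (j + i) thetaSer w := by
    have h0 := phiSer_eq_zero hN (hdvd.mul_left thetaSer) hd
    rw [mul_sub, map_sub, LinearMap.sub_apply, sub_eq_zero] at h0
    rw [h0, Finset.mul_sum, map_sum, LinearMap.sum_apply]
    refine Finset.sum_congr rfl fun i _ => ?_
    rw [mul_left_comm, phiSer_C, mul_comm, phiSer_X_pow_mul]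
  rw [neg_mul, map_neg, LinearMap.neg_apply, e1, phiSer_eq_sum hN f hd, phiSer_eq_sum hN f hd',
    ← thetaLin_apply, map_sum, ← sub_eq_add_neg, ← Finset.sum_sub_distrib]
  refine Finset.sum_congr rfl fun i _ => ?_
  rw [map_smul, thetaLin_apply, Theta_phi, smul_sub]

/-- Applying Θ either multiplies the series by `-thetaSer` or acts on the vector. These two
operations commute, so powers follow the binomial theorem. -/
lemma thetaLin_pow_phiSer (j : ℤ) (f : PowerSeries K) (w : E) (r : ℕ) :
    (thetaLin ^ r) (phiSer j f w) = ∑ p ∈ Finset.HasAntidiagonal.antidiagonal r,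
      r.choose p.1 • phiSer j ((-thetaSer) ^ p.1 * f) ((thetaLin ^ p.2) w) := by
  induction r with
  | zero => simp
  | succ r ih =>
    rw [Finset.sum_antidiagonal_choose_succ_nsmul (fun a b =>
      phiSer j ((-thetaSer) ^ a * f) ((thetaLin ^ b) w)) r, pow_succ', Module.End.mul_apply, ih,
      map_sum, ← Finset.sum_add_distrib]
    refine Finset.sum_congr rfl fun p hp => ?_
    rw [map_nsmul, thetaLin_apply, Theta_phiSer, smul_add, pow_succ', Module.End.mul_apply,
      pow_succ', mul_assoc, thetaLin_apply,
      Nat.choose_symm_of_eq_add (Finset.HasAntidiagonal.mem_antidiagonal.1 hp).symm]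

lemma thetaLin_pow_apply (r : ℕ) (w : E) : (thetaLin ^ r) w = Theta^[r] w := by
  rw [Module.End.pow_apply]; rfl

lemma thetaLin_pow_mem_EFilt {d : ℤ} {w : E} (hw : w ∈ EFilt d) (r : ℕ) :
    (thetaLin ^ r) w ∈ EFilt (d - r) := by
  induction r with
  | zero => simpa using hw
  | succ r ih =>
    rw [pow_succ', Module.End.mul_apply]
    have := Theta_mem_EFilt ih
    push_cast
    rwa [sub_sub] at this

lemma expTheta_eq_sum {d : ℤ} {R : ℕ} (h : d < R) {w : E} (hw : w ∈ EFilt d) :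
    expTheta w = ∑ r ∈ Finset.range R, ((r.factorial : K)⁻¹) • (thetaLin ^ r) w := by
  rw [expTheta, finsum_eq_sum_of_support_subset (s := Finset.range R)]
  · simp only [thetaLin_pow_apply]
  · intro r hr
    rw [Function.mem_support] at hr
    by_contra h'
    rw [Finset.coe_range, Set.mem_Iio] at h'
    exact hr (by
      rw [← thetaLin_pow_apply, EFilt_neg (by omega) (thetaLin_pow_mem_EFilt hw r), smul_zero])

/-- The right action of `e^Θ` as a linear map. -/
def expThetaLin : E →ₗ[K] E where
  toFun := expTheta
  map_add' u w := by
    obtain ⟨d, hd⟩ := exists_mem_EFilt u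
    obtain ⟨e, he⟩ := exists_mem_EFilt w
    have hd' := EFilt_mono (show (d : ℤ) ≤ (d + e : ℕ) by push_cast; omega) hd
    have he' := EFilt_mono (show (e : ℤ) ≤ (d + e : ℕ) by push_cast; omega) he
    have h : ((d + e : ℕ) : ℤ) < (d + e + 1 : ℕ) := by push_cast; omega
    rw [expTheta_eq_sum h hd', expTheta_eq_sum h he', expTheta_eq_sum h (add_mem hd' he')]
    simp only [map_add, smul_add, Finset.sum_add_distrib]
  map_smul' a w := by
    obtain ⟨d, hd⟩ := exists_mem_EFilt w
    have h : (d : ℤ) < (d + 1 : ℕ) := by push_cast; omega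
    rw [expTheta_eq_sum h hd, expTheta_eq_sum h (Submodule.smul_mem _ a hd), RingHom.id_apply,
      Finset.smul_sum]
    simp only [map_smul, smul_comm a]

@[simp] lemma expThetaLin_apply (w : E) : expThetaLin w = expTheta w := rfl

/-- The series `exp(-2 ∑_{n odd} (β/2)^n X^n / n)`. -/
def expNegTheta : PowerSeries K := (PowerSeries.exp K).subst (-thetaSer)

lemma constantCoeff_thetaSer : PowerSeries.constantCoeff (-thetaSer) = 0 := by
  rw [map_neg, ← PowerSeries.coeff_zero_eq_constantCoeff_apply, thetaSer, PowerSeries.coeff_mk]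
  simp

lemma hasSubst_thetaSer : PowerSeries.HasSubst (-thetaSer) :=
  PowerSeries.HasSubst.of_constantCoeff_zero' constantCoeff_thetaSer

lemma X_pow_dvd_thetaSer_pow (b : ℕ) : PowerSeries.X ^ b ∣ (-thetaSer) ^ b :=
  pow_dvd_pow_of_dvd (PowerSeries.X_dvd_iff.2 constantCoeff_thetaSer) b

/-- `-thetaSer` has no constant term, so its powers from R on do not reach degrees below R. -/
lemma X_pow_dvd_expNegTheta_sub (R : ℕ) : PowerSeries.X ^ R ∣ expNegTheta -
    ∑ b ∈ Finset.range R, ((b.factorial : K)⁻¹) • (-thetaSer) ^ b := by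
  rw [PowerSeries.X_pow_dvd_iff]
  intro m hm
  rw [map_sub, expNegTheta, PowerSeries.coeff_subst' hasSubst_thetaSer,
    finsum_eq_sum_of_support_subset (s := Finset.range R), map_sum, sub_eq_zero]
  · refine Finset.sum_congr rfl fun b _ => ?_
    rw [PowerSeries.coeff_exp, map_smul]
    simp
  · intro b hb
    rw [Function.mem_support] at hb
    by_contra h'
    rw [Finset.coe_range, Set.mem_Iio] at h'
    exact hb (by
      rw [PowerSeries.X_pow_dvd_iff.1 (X_pow_dvd_thetaSer_pow b) m (by omega), smul_zero])

/-- Conjugation of the fermions by `e^Θ`. -/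
lemma expTheta_phiSer (j : ℤ) (f : PowerSeries K) (w : E) :
    expTheta (phiSer j f w) = phiSer j (expNegTheta * f) (expTheta w) := by
  obtain ⟨d, hd⟩ := exists_mem_EFilt w
  -- The first bound makes the exponential series on w terminate before R; the second makes series
  -- divisible by X^R act as zero.
  obtain ⟨R, hR1, hR2⟩ : ∃ R : ℕ, (d : ℤ) < R ∧ (d : ℤ) < j + R := ⟨d + 1 + j.natAbs, by omega, by omega⟩
  have hu : phiSer j f w ∈ EFilt (d - j) := by
    rw [phiSer_eq_sum hR2 f hd]
    exact sum_mem fun i _ => Submodule.smul_mem _ _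
      (EFilt_mono (by omega) (phi_mem_EFilt (j + i) hd))
  set g : ℕ × ℕ → E := fun p => ((p.1.factorial : K)⁻¹ * (p.2.factorial : K)⁻¹) •
    phiSer j ((-thetaSer) ^ p.1 * f) ((thetaLin ^ p.2) w) with hg
  have e1 : expTheta (phiSer j f w) =
      ∑ r ∈ Finset.range R, ∑ p ∈ Finset.HasAntidiagonal.antidiagonal r, g p := by
    rw [expTheta_eq_sum (R := R) (by omega) hu]
    refine Finset.sum_congr rfl fun r _ => ?_
    rw [thetaLin_pow_phiSer, Finset.smul_sum]
    refine Finset.sum_congr rfl fun p hp => ?_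
    rw [hg, ← Nat.cast_smul_eq_nsmul K, smul_smul]
    congr 1
    rw [Finset.HasAntidiagonal.mem_antidiagonal] at hp
    subst hp
    rw [Nat.choose_symm_add]
    have h1 := Nat.add_choose_mul_factorial_mul_factorial p.1 p.2
    have h2 := congrArg (Nat.cast : ℕ → K) h1
    push_cast at h2
    have n1 : (p.1.factorial : K) ≠ 0 := by exact_mod_cast p.1.factorial_ne_zero
    have n2 : (p.2.factorial : K) ≠ 0 := by exact_mod_cast p.2.factorial_ne_zero
    have n3 : ((p.1 + p.2).factorial : K) ≠ 0 := by exact_mod_cast (p.1 + p.2).factorial_ne_zero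
    field_simp
    linear_combination h2
  -- The triangle may be completed to a square: Θ^b lowers the degree bound by b and `(-thetaSer)^a`
  -- raises the lowest fermion index by a, so terms with a + b ≥ R vanish.
  have e2 : ∑ r ∈ Finset.range R, ∑ p ∈ Finset.HasAntidiagonal.antidiagonal r, g p =
      ∑ p ∈ Finset.range R ×ˢ Finset.range R, g p := by
    have hmap : ∀ p ∈ (Finset.range R ×ˢ Finset.range R).filter (fun p => p.1 + p.2 < R),
        p.1 + p.2 ∈ Finset.range R := fun p hp => by simpa using (Finset.mem_filter.1 hp).2
    have : ∑ p ∈ (Finset.range R ×ˢ Finset.range R).filter (fun p => p.1 + p.2 < R), g p =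
        ∑ p ∈ Finset.range R ×ˢ Finset.range R, g p := by
      refine Finset.sum_subset (Finset.filter_subset _ _) fun p hp hp' => ?_
      have h3 : R ≤ p.1 + p.2 := by
        by_contra h
        exact hp' (Finset.mem_filter.2 ⟨hp, by omega⟩)
      rw [hg]
      simp only
      rw [phiSer_eq_zero (N := p.1) (by omega) ((X_pow_dvd_thetaSer_pow p.1).mul_right f)
        (thetaLin_pow_mem_EFilt hd p.2), smul_zero]
    rw [← this, ← Finset.sum_fiberwise_of_maps_to hmap]
    refine Finset.sum_congr rfl fun r hr => Finset.sum_congr ?_ fun _ _ => rfl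
    ext p
    simp only [Finset.HasAntidiagonal.mem_antidiagonal, Finset.mem_filter, Finset.mem_product, Finset.mem_range]
      at hr ⊢
    omega
  have hw' : expTheta w ∈ EFilt d := by
    rw [expTheta_eq_sum hR1 hd]
    exact sum_mem fun r _ => Submodule.smul_mem _ _
      (EFilt_mono (by omega) (thetaLin_pow_mem_EFilt hd r))
  have e3 := phiSer_eq_zero hR2 ((X_pow_dvd_expNegTheta_sub R).mul_right f) hw'
  rw [sub_mul, map_sub, LinearMap.sub_apply, sub_eq_zero] at e3
  rw [e1, e2, e3, Finset.sum_mul, map_sum, LinearMap.sum_apply, Finset.sum_product]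
  refine Finset.sum_congr rfl fun a _ => ?_
  rw [expTheta_eq_sum hR1 hd, map_sum]
  refine Finset.sum_congr rfl fun b _ => ?_
  rw [hg, smul_mul_assoc, map_smul, map_smul, LinearMap.smul_apply, smul_smul, mul_comm]

/-- The exponent is log((1 - γX)/(1 + γX)). Differentiation replaces the logarithm: the difference y
of the two sides has zero constant term and satisfies (1 - γX) y' = -γ y, which forces y = 0
coefficient by coefficient. -/
lemma expNegTheta_mul : expNegTheta * (1 + PowerSeries.C γ * PowerSeries.X) =
    1 - PowerSeries.C γ * PowerSeries.X := by
  have d1 : PowerSeries.derivative K expNegTheta =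
      - (expNegTheta * PowerSeries.derivative K thetaSer) := by
    rw [expNegTheta, PowerSeries.derivative_subst hasSubst_thetaSer, PowerSeries.derivative_exp,
      map_neg, mul_neg]
  -- The derivative of the odd logarithm is the geometric series 2γ/(1 - γ²X²).
  have d2 : (1 - PowerSeries.C (γ ^ 2) * PowerSeries.X ^ 2) *
      PowerSeries.derivative K thetaSer = PowerSeries.C (2 * γ) := by
    have hc : ∀ n, PowerSeries.coeff n (PowerSeries.derivative K thetaSer) =
        if Even n then 2 * γ ^ (n + 1) else 0 := by
      intro n
      rw [PowerSeries.coeff_derivative, thetaSer, PowerSeries.coeff_mk]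
      by_cases h : Even n
      · rw [if_pos h, if_pos h.add_one]
        have : ((n + 1 : ℕ) : K) ≠ 0 := by exact_mod_cast n.succ_ne_zero
        push_cast at this ⊢
        field_simp
      · rw [if_neg h, if_neg, zero_mul]
        rwa [Nat.odd_add_one, Nat.not_odd_iff_even]
    ext n
    rw [sub_mul, one_mul, map_sub, hc, mul_assoc, PowerSeries.coeff_C_mul,
      PowerSeries.coeff_X_pow_mul', PowerSeries.coeff_C]
    rcases n with _ | _ | n
    · simp
    · simp
    · rw [if_pos (show 2 ≤ n + 1 + 1 by omega), show n + 1 + 1 - 2 = n by omega, hc,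
        if_neg (show ¬ n + 1 + 1 = 0 by omega)]
      have : Even (n + 1 + 1) ↔ Even n := by simp [Nat.even_add_one]
      simp only [this]
      split_ifs <;> ring
  set y := expNegTheta * (1 + PowerSeries.C γ * PowerSeries.X) -
    (1 - PowerSeries.C γ * PowerSeries.X) with hy
  have dy : (1 - PowerSeries.C γ * PowerSeries.X) * PowerSeries.derivative K y =
      - (PowerSeries.C γ * y) := by
    have hne : (1 + PowerSeries.C γ * PowerSeries.X : PowerSeries K) ≠ 0 := by
      intro h
      have := congrArg PowerSeries.constantCoeff h
      simp at this
    refine mul_left_cancel₀ hne ?_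
    have d3 : PowerSeries.derivative K y = PowerSeries.derivative K expNegTheta *
        (1 + PowerSeries.C γ * PowerSeries.X) + expNegTheta * PowerSeries.C γ +
        PowerSeries.C γ := by
      rw [hy]
      simp only [map_sub, Derivation.leibniz, map_add, Derivation.map_one_eq_zero, smul_eq_mul,
        PowerSeries.derivative_X, PowerSeries.derivative_C]
      ring
    rw [d3, d1, hy]
    have c2 : (PowerSeries.C (γ ^ 2) : PowerSeries K) = PowerSeries.C γ ^ 2 := map_pow _ _ _
    have c3 : (PowerSeries.C (2 * γ) : PowerSeries K) = 2 * PowerSeries.C γ := by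
      rw [map_mul]; rfl
    rw [c2, c3] at d2
    linear_combination -expNegTheta * (1 + PowerSeries.C γ * PowerSeries.X) * d2
  have hy0 : ∀ n, PowerSeries.coeff n y = 0 := by
    intro n
    induction n with
    | zero =>
      have h1 : PowerSeries.constantCoeff expNegTheta = 1 := by
        have := PowerSeries.X_pow_dvd_iff.1 (X_pow_dvd_expNegTheta_sub 1) 0 (by omega)
        simpa [sub_eq_zero] using this
      simp [hy, h1]
    | succ n ih =>
      have h := congrArg (PowerSeries.coeff n) dy
      rw [sub_mul, one_mul, map_sub, map_neg, mul_assoc, PowerSeries.coeff_C_mul,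
        PowerSeries.coeff_C_mul, ih, PowerSeries.coeff_derivative] at h
      rcases n with _ | n
      · simpa using h
      · rw [PowerSeries.coeff_succ_X_mul, PowerSeries.coeff_derivative, ih] at h
        have : (n : K) + 1 + 1 ≠ 0 := by exact_mod_cast (n + 1).succ_ne_zero
        simpa [this] using h
  exact sub_eq_zero.1 (by ext n; rw [hy0 n, map_zero])

/-- The relation `(φ_j + (β/2) φ_{j+1}) e^Θ = e^Θ (φ_j - (β/2) φ_{j+1})`. -/
lemma expTheta_phi_add (j : ℤ) (w : E) :
    expTheta (phi j w) + γ • expTheta (phi (j + 1) w) =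
      phi j (expTheta w) - γ • phi (j + 1) (expTheta w) := by
  have h := expTheta_phiSer j (1 + PowerSeries.C γ * PowerSeries.X) w
  rw [expNegTheta_mul, map_add, map_sub, LinearMap.add_apply, LinearMap.sub_apply, phiSer_one,
    phiSer_one, phiSer_C, phiSer_C, phiSer_X, phiSer_X, ← expThetaLin_apply, map_add,
    map_smul] at h
  exact h

/-- `⟨0|e^Θ = ⟨0|`. -/
lemma expTheta_vac : expTheta vac = vac := by
  rw [expTheta_eq_sum (R := 1) (by norm_num) vac_mem_EFilt]
  simp

/-! ### Conjugation of the Heisenberg generators by `e^Θ` -/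

lemma odd_natCast {m : ℕ} (hm : Odd m) : Odd (m : ℤ) := by exact_mod_cast hm

/-- Only the summand of Θ containing b_{-m} fails to commute with b_m; its coefficient 2γ^m/m meets
the central term m/2. -/
lemma Theta_heis {m : ℕ} (hm : Odd m) (w : E) :
    Theta (heis m w) = heis m (Theta w) + γ ^ m • w := by
  have hm' := odd_natCast hm
  have hpos : (0 : ℤ) < m := by exact_mod_cast hm.pos
  obtain ⟨k, hk⟩ := hm
  have e1 : heis m (Theta w) = ∑ᶠ j : ℕ, heisLin m hm'
      ((2 * γ ^ (2 * j + 1) / (2 * j + 1 : ℕ) : K) • heis (-(2 * j + 1 : ℕ)) w) := by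
    rw [← heisLin_apply hm', Theta, map_finsum _ (Theta_finite w)]
  have f1 : (Function.support fun j : ℕ => heisLin m hm'
      ((2 * γ ^ (2 * j + 1) / (2 * j + 1 : ℕ) : K) • heis (-(2 * j + 1 : ℕ)) w)).Finite :=
    (Theta_finite w).subset fun i hi h => hi (by
      simp only at h ⊢
      rw [h, map_zero])
  have e2 : γ ^ m • w = ∑ᶠ j : ℕ, if j = k then γ ^ m • w else 0 := by
    rw [finsum_eq_single _ k fun j hj => if_neg hj, if_pos rfl]
  rw [e1, e2, ← finsum_add_distrib f1, Theta]
  · refine finsum_congr fun j => ?_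
    rw [map_smul, heisLin_apply, heis_neg_heis hm' (by simp) hpos (by positivity), smul_add]
    congr 1
    by_cases hj : j = k
    · subst hj
      rw [if_pos (by exact_mod_cast hk), if_pos rfl, smul_smul, ← hk]
      congr 1
      have : (m : K) ≠ 0 := by rw [hk]; exact_mod_cast (2 * j).succ_ne_zero
      push_cast
      field_simp
    · rw [if_neg (by omega), if_neg hj, zero_smul, smul_zero]
  · exact (Set.finite_singleton k).subset fun i hi => by
      by_contra h; exact hi (if_neg h)

/-- The commutator [b_m, Θ] = γ^m is a scalar, so commuting b_m with Θ^{r+1} acts as γ^m times the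
derivative with respect to Θ. -/
lemma thetaLin_pow_heis {m : ℕ} (hm : Odd m) (r : ℕ) (w : E) :
    (thetaLin ^ (r + 1)) (heis m w) =
      heis m ((thetaLin ^ (r + 1)) w) + ((r + 1 : ℕ) * γ ^ m : K) • (thetaLin ^ r) w := by
  induction r with
  | zero => simp [Theta_heis hm]
  | succ r ih =>
    rw [pow_succ', Module.End.mul_apply, ih, map_add, map_smul, thetaLin_apply, Theta_heis hm,
      ← thetaLin_apply, ← Module.End.mul_apply, ← pow_succ', ← Module.End.mul_apply thetaLin,
      ← pow_succ']
    rw [add_assoc, ← add_smul]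
    congr 2
    push_cast
    ring

/-- The relation `b_m e^Θ = e^Θ (b_m + (β/2)^m)` for odd `m > 0`. -/
lemma expTheta_heis {m : ℕ} (hm : Odd m) (w : E) :
    expTheta (heis m w) = heis m (expTheta w) + γ ^ m • expTheta w := by
  have hm' := odd_natCast hm
  obtain ⟨d, hd⟩ := exists_mem_EFilt w
  have hd' : w ∈ EFilt ((d + m : ℕ) : ℤ) := EFilt_mono (by push_cast; omega) hd
  have hh : heis m w ∈ EFilt ((d + m : ℕ) : ℤ) := by
    have := heis_mem_EFilt m hd
    push_cast; exact this
  obtain ⟨N, hN⟩ : ∃ N : ℕ, ((d + m : ℕ) : ℤ) < N := ⟨d + m + 1, by push_cast; omega⟩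
  -- The truncations have different lengths because differentiation in Θ lowers the exponent by one;
  -- the term r = 0 is split off as it has no commutator.
  rw [expTheta_eq_sum (R := N + 1) (by push_cast at hN ⊢; omega) hh,
    ← heisLin_apply hm' (expTheta w),
    show heisLin m hm' (expTheta w) = heisLin m hm' (∑ r ∈ Finset.range (N + 1),
      ((r.factorial : K)⁻¹) • (thetaLin ^ r) w) by
      rw [expTheta_eq_sum (R := N + 1) (by push_cast at hN ⊢; omega) hd'],
    expTheta_eq_sum hN hd', Finset.sum_range_succ',
    Finset.sum_range_succ' _ N, map_add, map_sum, add_right_comm, Finset.smul_sum,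
    ← Finset.sum_add_distrib]
  congr 1
  · refine Finset.sum_congr rfl fun r _ => ?_
    rw [thetaLin_pow_heis hm, map_smul, heisLin_apply, smul_add, smul_smul,
      smul_smul]
    congr 2
    have n1 : (r.factorial : K) ≠ 0 := by exact_mod_cast r.factorial_ne_zero
    have n2 : ((r + 1 : ℕ) : K) ≠ 0 := by exact_mod_cast r.succ_ne_zero
    rw [Nat.factorial_succ, Nat.cast_mul]
    field_simp
  · simp

/-! ### The linear functional `⟨w| ↦ ⟨w|e^Θ φ^{(β)}_0 e^Θ|0⟩` -/

/-- The series `∑_i a^i X^i`. -/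
def geomSer {A : Type*} [CommRing A] (a : A) : PowerSeries A := PowerSeries.mk fun i => a ^ i

lemma one_sub_mul_geomSer {A : Type*} [CommRing A] (a : A) :
    (1 - PowerSeries.C a * PowerSeries.X) * geomSer a = 1 := by
  ext n
  rw [sub_mul, one_mul, map_sub, mul_assoc, PowerSeries.coeff_C_mul, PowerSeries.coeff_one]
  rcases n with _ | n
  · simp [geomSer]
  · rw [PowerSeries.coeff_succ_X_mul, geomSer, PowerSeries.coeff_mk, PowerSeries.coeff_mk,
      if_neg n.succ_ne_zero]
    ring

/-- The numerator 1 - γX of `expNegTheta` cancels the pole of 1/(1 - γX), leaving 1/(1 + γX). -/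
lemma expNegTheta_mul_geomSer : expNegTheta * geomSer γ = geomSer (-γ) := by
  have h1 := one_sub_mul_geomSer γ
  have h2 := one_sub_mul_geomSer (-γ)
  rw [map_neg] at h2
  linear_combination geomSer γ * geomSer (-γ) * expNegTheta_mul + geomSer (-γ) * h1 -
    geomSer γ * expNegTheta * h2

/-- The right action of `φ^{(β)}_n` as a linear map. -/
def phiBetaLin (n : ℤ) : E →ₗ[K] E where
  toFun := phiBeta n
  map_add' u w := by
    simp only [phiBeta]
    rw [← finsum_add_distrib (phiBeta_finite n u) (phiBeta_finite n w)]
    simp only [map_add, smul_add]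
  map_smul' a w := by
    simp only [phiBeta, RingHom.id_apply]
    rw [smul_finsum' a (phiBeta_finite n w)]
    simp only [map_smul, smul_comm a]

/-- The coefficient of φ_m is the constant term γ^m of (z + γ)^m, and negative fermions do not
occur. -/
lemma phiBeta_zero (w : E) : phiBeta 0 w = phiSer 0 (geomSer γ) w := by
  rw [phiBeta, phiSer_apply, ← finsum_mem_univ, ← finsum_mem_inter_support, Set.univ_inter]
  have : Function.support (fun m : ℤ => phiBetaCoeff 0 m • phi m w) =
      Set.range (Nat.cast : ℕ → ℤ) ∩
        Function.support (fun m : ℤ => phiBetaCoeff 0 m • phi m w) := by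
    refine (Set.inter_eq_right.2 fun m hm => ?_).symm
    by_contra h
    refine hm ?_
    rcases m with m | m
    · exact absurd ⟨m, rfl⟩ h
    · exact zero_smul _ _
  rw [this, finsum_mem_inter_support, finsum_mem_range Nat.cast_injective]
  refine finsum_congr fun k => ?_
  rw [zero_add, geomSer, PowerSeries.coeff_mk]
  congr 1
  change ((Polynomial.X + Polynomial.C γ) ^ k : Polynomial K).coeff 0 = _
  rw [Polynomial.coeff_zero_eq_eval_zero]
  simp

/-- The functional `⟨w| ↦ ⟨w|e^Θ φ^{(β)}_0 e^Θ|0⟩`. -/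
def kappa : E →ₗ[K] K := pairVac ∘ₗ expThetaLin ∘ₗ phiBetaLin 0 ∘ₗ expThetaLin

lemma kappa_apply (w : E) : kappa w = pairVac (expTheta (phiBeta 0 (expTheta w))) := rfl

lemma pairVac_expTheta_phiSer (j : ℤ) (u : E) :
    pairVac (expTheta (phiSer j (geomSer γ) u)) =
      pairVac (phiSer j (geomSer (-γ)) (expTheta u)) := by
  rw [expTheta_phiSer, expNegTheta_mul_geomSer]

lemma geomSer_eq (a : K) (m : ℕ) : geomSer a =
    ∑ i ∈ Finset.range m, PowerSeries.C (a ^ i) * PowerSeries.X ^ i +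
      PowerSeries.C (a ^ m) * (PowerSeries.X ^ m * geomSer a) := by
  ext n
  simp only [map_add, map_sum, PowerSeries.coeff_C_mul, PowerSeries.coeff_X_pow,
    PowerSeries.coeff_X_pow_mul', geomSer, PowerSeries.coeff_mk, mul_ite, mul_one, mul_zero,
    Finset.sum_ite_eq, Finset.mem_range]
  rcases lt_or_ge n m with h | h
  · rw [if_pos h, if_neg (by omega), add_zero]
  · rw [if_neg (by omega), if_pos h, zero_add, ← pow_add, add_tsub_cancel_of_le h]

/-- Fermions of negative index vanish against |0⟩, and dropping the first m terms of a geometric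
series multiplies it by a^m. -/
lemma pairVac_phiSer_neg (a : K) (m : ℕ) (u : E) :
    pairVac (phiSer (-m) (geomSer a) u) = a ^ m * pairVac (phiSer 0 (geomSer a) u) := by
  conv_lhs => rw [geomSer_eq a m]
  rw [map_add, LinearMap.add_apply, map_add, phiSer_C, phiSer_X_pow_mul, neg_add_cancel,
    map_smul, smul_eq_mul, add_eq_right, map_sum, LinearMap.sum_apply, map_sum]
  refine Finset.sum_eq_zero fun i hi => ?_
  rw [Finset.mem_range] at hi
  have := phiSer_X_pow_mul (-m) i 1 u
  rw [mul_one] at this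
  rw [phiSer_C, this, phiSer_one, map_smul, pairVac_phi_neg (by omega), smul_zero]

lemma phiSer_heis {m : ℤ} (hm : Odd m) (j : ℤ) (f : PowerSeries K) (w : E) :
    phiSer j f (heis m w) = heis m (phiSer j f w) + phiSer (j - m) f w := by
  rw [phiSer_apply, phiSer_apply, phiSer_apply, ← heisLin_apply hm (∑ᶠ _, _),
    map_finsum _ (phiSer_finite j f w), ← finsum_add_distrib _ (phiSer_finite (j - m) f w)]
  · refine finsum_congr fun i => ?_
    rw [map_smul, heisLin_apply, phi_heis hm, smul_add, add_sub_right_comm]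
  · exact (phiSer_finite j f w).subset fun i hi h => hi (by
      simp only at h ⊢
      rw [h, map_zero])

/-- Of the two factors e^Θ only the left one contributes a net scalar γ^m. -/
lemma kappa_heis {m : ℕ} (hm : Odd m) (w : E) : kappa (heis m w) = γ ^ m * kappa w := by
  have hm' := odd_natCast hm
  -- Passing the right-hand e^Θ gives γ^m. The commutator with φ^{(β)}_0 shifts its index by -m,
  -- which gives (-γ)^m = -γ^m for odd m. The two cancel, and b_m|0⟩ = 0.
  have key : ∀ u, pairVac (expTheta (phiBeta 0 (heis m u))) = 0 := by
    intro u
    rw [phiBeta_zero, phiSer_heis hm', ← expThetaLin_apply, map_add, expThetaLin_apply,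
      expThetaLin_apply, expTheta_heis hm, map_add, map_add,
      pairVac_heis (by exact_mod_cast hm.pos), zero_add, map_smul, zero_sub,
      pairVac_expTheta_phiSer, pairVac_expTheta_phiSer, pairVac_phiSer_neg, hm.neg_pow,
      smul_eq_mul]
    ring
  rw [kappa_apply, kappa_apply, expTheta_heis hm]
  change (pairVac ∘ₗ expThetaLin ∘ₗ phiBetaLin 0) _ = _
  rw [map_add, map_smul]
  change pairVac (expTheta (phiBeta 0 (heis m (expTheta w)))) + _ = _
  rw [key, zero_add]
  rfl

/-- Only the index i = l pairs with φ_{-l}. This gives 1 for l = 0, where φ_0² = 1, and 2γ^l for l >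
0, which are the coefficients of (1 + γX)/(1 - γX). -/
lemma pairVac_phiSer_phi_vac (l : ℕ) : pairVac (phiSer 0 (geomSer (-γ)) (phi (-l) vac)) =
    PowerSeries.coeff l ((1 + PowerSeries.C γ * PowerSeries.X) * geomSer γ) := by
  rw [phiSer_apply, map_finsum _ (phiSer_finite _ _ _), finsum_eq_single _ l]
  · rw [zero_add, geomSer, PowerSeries.coeff_mk, map_smul, add_mul, one_mul, map_add, mul_assoc,
      PowerSeries.coeff_C_mul, geomSer, PowerSeries.coeff_mk]
    rcases l with _ | l
    · have h := phi_anticomm 0 0 vac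
      have h2 : (2 : K) * pairVac (phi 0 (phi 0 vac)) = 2 := by
        have := congrArg pairVac h
        simp only [add_zero, if_true, map_add, map_smul, pairVac_vac] at this
        simpa [two_mul] using this
      have h3 : pairVac (phi 0 (phi 0 vac)) = 1 := by
        have := mul_left_cancel₀ (two_ne_zero' K) (h2.trans (mul_one 2).symm)
        exact this
      simp [h3]
    · have h := phi_anticomm (-(l + 1 : ℕ)) (l + 1 : ℕ) vac
      rw [if_pos (by ring), phi_vac (n := ((l + 1 : ℕ) : ℤ)) (by positivity), map_zero, add_zero]
        at h
      rw [h, PowerSeries.coeff_succ_X_mul, PowerSeries.coeff_mk, map_smul, pairVac_vac,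
        Int.natAbs_neg, Int.natAbs_natCast, neg_pow, smul_eq_mul, smul_eq_mul, mul_one]
      have : ((-1 : K) ^ (l + 1)) * (-1) ^ (l + 1) = 1 := by rw [← mul_pow]; simp
      linear_combination 2 * γ ^ (l + 1) * this
  · intro i hi
    have h := phi_anticomm (-l) i vac
    rw [if_neg (by omega)] at h
    rw [zero_add, eq_neg_of_add_eq_zero_left h, map_smul, map_neg]
    rcases Nat.eq_zero_or_pos i with rfl | hi'
    · rw [pairVac_phi_neg (by omega), neg_zero, smul_zero]
    · rw [phi_vac (by exact_mod_cast hi'), map_zero, map_zero, neg_zero, smul_zero]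

/-- The values `⟨0|φ_n φ^{(β)}_0 e^Θ|0⟩` after conjugation by `e^Θ`. -/
lemma pairVac_expTheta_phiBeta_phi_vac {n : ℤ} (hn : n ≤ 0) :
    pairVac (phiSer 0 (geomSer (-γ)) (expTheta (phi n vac))) = if n = 0 then 1 else 0 := by
  obtain ⟨k, rfl⟩ : ∃ k : ℕ, n = -k := ⟨n.natAbs, by omega⟩
  -- Conjugation by e^Θ convolves the two-point values with the inverse of their generating series,
  -- so only the index 0 survives.
  have e1 : expNegTheta * ((1 + PowerSeries.C γ * PowerSeries.X) * geomSer γ) = 1 := by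
    rw [← mul_assoc, expNegTheta_mul, one_sub_mul_geomSer]
  rw [← phiSer_one, expTheta_phiSer, mul_one, expTheta_vac,
    phiSer_eq_sum (d := 0) (N := k + 1) (by push_cast; omega) _ vac_mem_EFilt, map_sum, map_sum]
  have e2 := congrArg (PowerSeries.coeff k) e1
  rw [PowerSeries.coeff_mul, Finset.Nat.sum_antidiagonal_eq_sum_range_succ (fun i j =>
    PowerSeries.coeff i expNegTheta *
      PowerSeries.coeff j ((1 + PowerSeries.C γ * PowerSeries.X) * geomSer γ)),
    PowerSeries.coeff_one] at e2
  have h0 : (-(k : ℤ) = 0) ↔ k = 0 := by omega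
  simp only [h0]
  rw [← e2]
  refine Finset.sum_congr rfl fun i hi => ?_
  rw [Finset.mem_range] at hi
  rw [map_smul, map_smul, smul_eq_mul, show -(k : ℤ) + i = -(k - i : ℕ) by omega,
    pairVac_phiSer_phi_vac]

/-- The combination φ_j + γφ_{j+1} clears the denominator 1 + γX of the conjugation by e^Θ, so the
left e^Θ can be moved past it with finitely many terms. -/
lemma kappa_phi_add (j : ℤ) (w : E) :
    kappa (phi j w) + γ * kappa (phi (j + 1) w) =
      pairVac (phiSer 0 (geomSer (-γ)) (expTheta (phi j (expTheta w)))) -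
        γ * pairVac (phiSer 0 (geomSer (-γ)) (expTheta (phi (j + 1) (expTheta w)))) := by
  have e : ∀ u, (pairVac ∘ₗ expThetaLin ∘ₗ phiBetaLin 0) u =
      pairVac (phiSer 0 (geomSer (-γ)) (expTheta u)) := fun u => by
    rw [← pairVac_expTheta_phiSer, ← phiBeta_zero]
    rfl
  have h := congrArg (pairVac ∘ₗ expThetaLin ∘ₗ phiBetaLin 0) (expTheta_phi_add j w)
  rw [map_add, map_sub, map_smul, map_smul, e (phi j _), e (phi (j + 1) _)] at h
  exact h

/-- In generating function form this reads (z + γ) S = z - γ, where S = ∑ κ(⟨0|φ_n) z^n. -/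
lemma kappa_phi_vac (n : ℤ) : kappa (phi (n - 1) vac) + γ * kappa (phi n vac) =
    if n = 1 then 1 else if n = 0 then -γ else 0 := by
  have h := kappa_phi_add (n - 1) vac
  rw [sub_add_cancel, expTheta_vac] at h
  have z : expTheta 0 = 0 := expThetaLin.map_zero
  rw [h]
  rcases lt_trichotomy n 1 with hn | hn | hn
  · rw [if_neg hn.ne, pairVac_expTheta_phiBeta_phi_vac (by omega),
      pairVac_expTheta_phiBeta_phi_vac (by omega), if_neg (by omega)]
    split_ifs <;> simp
  · subst hn
    rw [pairVac_expTheta_phiBeta_phi_vac (by omega), phi_vac (n := 1) (by omega), z, map_zero]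
    simp
  · rw [phi_vac (n := n) (by omega), phi_vac (n := n - 1) (by omega), z, map_zero,
      if_neg (by omega), if_neg (by omega)]
    simp

/-! ### The substitution `z ↦ z + β/2` in Laurent series in `z⁻¹` -/

lemma coeff_zinv_series_mul (a : K) :
    (1 + PowerSeries.C a * PowerSeries.X) *
      (PowerSeries.X * (1 + PowerSeries.C a * PowerSeries.X)⁻¹) = (PowerSeries.X : PowerSeries K) := by
  rw [mul_left_comm, PowerSeries.mul_inv_cancel _ (by simp), mul_one]

lemma phiBetaCoeff_zero_right (n : ℤ) : phiBetaCoeff n 0 = if n = 0 then 1 else 0 := by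
  rcases n with n | n
  · change ((Polynomial.X + Polynomial.C γ) ^ 0 : Polynomial K).coeff n = _
    rw [pow_zero, Polynomial.coeff_one]
    simp
  · exact (if_neg (by simp)).symm

/-- Both halves of the definition expand powers of z + γ in descending powers of z, because z⁻¹/(1 +
γz⁻¹) = (z + γ)⁻¹. The recursion is multiplication by z + γ, and it also holds across the boundary
from m = -1 to m = 0. -/
lemma phiBetaCoeff_succ (n m : ℤ) :
    phiBetaCoeff n (m + 1) = phiBetaCoeff (n - 1) m + γ * phiBetaCoeff n m := by
  set g : PowerSeries K := PowerSeries.X * (1 + PowerSeries.C γ * PowerSeries.X)⁻¹ with hg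
  have hgX : (1 + PowerSeries.C γ * PowerSeries.X) * g = PowerSeries.X := coeff_zinv_series_mul γ
  have hcoeff : ∀ k l : ℕ, PowerSeries.coeff (k + 2) (g ^ (l + 1)) +
      γ * PowerSeries.coeff (k + 1) (g ^ (l + 1)) = PowerSeries.coeff (k + 1) (g ^ l) := by
    intro k l
    have : g ^ (l + 1) + PowerSeries.C γ * (PowerSeries.X * g ^ (l + 1)) =
        PowerSeries.X * g ^ l := by
      linear_combination g ^ l * hgX
    have h := congrArg (PowerSeries.coeff (k + 2)) this
    rw [map_add, PowerSeries.coeff_C_mul, PowerSeries.coeff_succ_X_mul,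
      PowerSeries.coeff_succ_X_mul] at h
    exact h
  have hc1 : ∀ l : ℕ, PowerSeries.coeff 1 (g ^ (l + 1)) = if l = 0 then 1 else 0 := by
    intro l
    have : g ^ (l + 1) + PowerSeries.C γ * (PowerSeries.X * g ^ (l + 1)) =
        PowerSeries.X * g ^ l := by
      linear_combination g ^ l * hgX
    have h := congrArg (PowerSeries.coeff (0 + 1)) this
    rw [map_add, PowerSeries.coeff_C_mul, PowerSeries.coeff_succ_X_mul,
      PowerSeries.coeff_succ_X_mul] at h
    simpa [hg, zero_pow_eq] using h
  rcases m with m | m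
  · rcases n with n | n
    · change ((Polynomial.X + Polynomial.C γ) ^ (m + 1) : Polynomial K).coeff n = _
      rw [pow_succ, mul_add, Polynomial.coeff_add, Polynomial.coeff_mul_C, mul_comm _ γ]
      rcases n with _ | n
      · rw [Polynomial.coeff_zero_eq_eval_zero]
        simp [phiBetaCoeff]
      · rw [Polynomial.coeff_mul_X]
        have : (Int.ofNat (n + 1) : ℤ) - 1 = Int.ofNat n := by simp
        rw [this]
        rfl
    · have : Int.negSucc n - 1 = Int.negSucc (n + 1) := rfl
      rw [this]
      change (0 : K) = 0 + γ * 0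
      ring
  · rcases m with _ | m
    · rw [show (Int.negSucc 0 + 1) = 0 from rfl, phiBetaCoeff_zero_right]
      rcases n with n | n
      · rcases n with _ | n
        · change _ = PowerSeries.coeff 1 (g ^ 1) + γ * 0
          rw [hc1 0]
          simp
        · have : (Int.ofNat (n + 1) : ℤ) - 1 = Int.ofNat n := by simp
          rw [this, if_neg (by simp; omega)]
          change (0 : K) = 0 + γ * 0
          ring
      · rw [if_neg (by simp)]
        change (0 : K) = PowerSeries.coeff (n + 1 + 1) (g ^ 1) + γ * PowerSeries.coeff (n + 1) (g ^ 1)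
        rw [hcoeff n 0, pow_zero, PowerSeries.coeff_one, if_neg n.succ_ne_zero]
    · rw [show (Int.negSucc (m + 1) + 1) = Int.negSucc m from rfl]
      rcases n with n | n
      · rcases n with _ | n
        · change (0 : K) = PowerSeries.coeff 1 (g ^ (m + 1 + 1)) + γ * 0
          rw [hc1]
          simp
        · have : (Int.ofNat (n + 1) : ℤ) - 1 = Int.ofNat n := by simp
          rw [this]
          change (0 : K) = 0 + γ * 0
          ring
      · exact (hcoeff n (m + 1)).symm

lemma zSubst_finite (f : L) (n : ℤ) :
    (Function.support fun m : ℤ => phiBetaCoeff n m * f.coeff (-m)).Finite := by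
  refine (Set.finite_Icc n (-f.order)).subset fun m hm => ?_
  rw [Function.mem_support] at hm
  constructor
  · by_contra h
    exact hm (by rw [phiBetaCoeff_eq_zero (by omega), zero_mul])
  · by_contra h
    exact hm (by rw [HahnSeries.coeff_eq_zero_of_lt_order (by omega), mul_zero])

lemma zSubst_bddBelow (f : L) : BddBelow (Function.support fun a : ℤ =>
    ∑ᶠ m : ℤ, phiBetaCoeff (-a) m * f.coeff (-m)) := by
  refine ⟨f.order, fun a ha => ?_⟩
  by_contra h
  refine ha ?_
  rw [← finsum_zero]
  refine finsum_congr fun m => ?_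
  rcases lt_or_ge m (-a) with hm | hm
  · rw [phiBetaCoeff_eq_zero hm, zero_mul]
  · rw [HahnSeries.coeff_eq_zero_of_lt_order (by omega), mul_zero]

/-- The substitution `z ↦ z + β/2` in `k((z⁻¹))`. -/
def zSubst : L →ₗ[K] L where
  toFun f := HahnSeries.ofSuppBddBelow _ (zSubst_bddBelow f)
  map_add' f g := by
    ext a
    simp only [HahnSeries.coeff_add, HahnSeries.coeff_ofSuppBddBelow, mul_add]
    exact finsum_add_distrib (zSubst_finite f _) (zSubst_finite g _)
  map_smul' a f := by
    ext b
    simp only [HahnSeries.coeff_smul, HahnSeries.coeff_ofSuppBddBelow, RingHom.id_apply]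
    rw [smul_finsum' a (zSubst_finite f _)]
    simp only [smul_eq_mul, mul_left_comm]

lemma coeff_zSubst (f : L) (a : ℤ) :
    (zSubst f).coeff a = ∑ᶠ m : ℤ, phiBetaCoeff (-a) m * f.coeff (-m) := rfl

lemma zSubst_one : zSubst 1 = 1 := by
  ext a
  rw [coeff_zSubst, finsum_eq_single _ 0, phiBetaCoeff_zero_right, HahnSeries.coeff_one,
    HahnSeries.coeff_one]
  · simp
  · intro m hm
    rw [HahnSeries.coeff_one, if_neg (by omega), mul_zero]

lemma coeff_z_mul (f : L) (a : ℤ) : (z * f).coeff a = f.coeff (a + 1) := by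
  rw [z, HahnSeries.coeff_single_mul, one_mul, sub_neg_eq_add]

lemma coeff_C_mul (c : K) (f : L) (a : ℤ) : (HahnSeries.C c * f).coeff a = c * f.coeff a := by
  rw [HahnSeries.C_mul_eq_smul, HahnSeries.coeff_smul, smul_eq_mul]

/-- Compatibility with multiplication by z and by constants is the only multiplicativity of the
substitution that the argument uses. -/
lemma zSubst_z_mul (f : L) : zSubst (z * f) = (z + HahnSeries.C γ) * zSubst f := by
  ext a
  rw [add_mul, HahnSeries.coeff_add, coeff_z_mul, coeff_C_mul, coeff_zSubst, coeff_zSubst,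
    coeff_zSubst, ← smul_eq_mul γ, smul_finsum' _ (zSubst_finite f _),
    ← finsum_add_distrib (zSubst_finite f _),
    ← finsum_comp_equiv (Equiv.addRight (1 : ℤ))]
  · refine finsum_congr fun m => ?_
    rw [Equiv.coe_addRight, phiBetaCoeff_succ, coeff_z_mul, show -(m + 1) + 1 = -m by ring,
      show -(a + 1) = -a - 1 by ring, smul_eq_mul]
    ring
  · refine (zSubst_finite f (-a)).subset fun m hm h => hm ?_
    simp only at h ⊢
    rw [h, smul_zero]

lemma zSubst_z_pow_mul (k : ℕ) (f : L) :
    zSubst (z ^ k * f) = (z + HahnSeries.C γ) ^ k * zSubst f := by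
  induction k with
  | zero => simp
  | succ k ih => rw [pow_succ', mul_assoc, zSubst_z_mul, ih, pow_succ', mul_assoc]

lemma zSubst_C_mul (c : K) (f : L) : zSubst (HahnSeries.C c * f) = HahnSeries.C c * zSubst f := by
  rw [HahnSeries.C_mul_eq_smul, HahnSeries.C_mul_eq_smul, map_smul]

/-! ### The generating function of the vacuum expectation values -/

lemma kappaSeries_bddBelow (w : E) :
    BddBelow (Function.support fun a : ℤ => kappa (phi (-a) w)) := by
  obtain ⟨d, hd⟩ := exists_mem_EFilt w
  refine ⟨-d, fun a ha => ?_⟩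
  by_contra h
  exact ha (by simp only; rw [phi_eq_zero (by omega) hd, map_zero])

/-- The generating function `∑_n ⟨w|φ_n e^Θ φ^{(β)}_0 e^Θ|0⟩ z^n`. -/
def kappaSeries : E →ₗ[K] L where
  toFun w := HahnSeries.ofSuppBddBelow _ (kappaSeries_bddBelow w)
  map_add' u w := by
    ext a
    simp only [HahnSeries.coeff_add, HahnSeries.coeff_ofSuppBddBelow, map_add]
  map_smul' c w := by
    ext a
    simp only [HahnSeries.coeff_smul, HahnSeries.coeff_ofSuppBddBelow, map_smul, RingHom.id_apply]

lemma coeff_kappaSeries (w : E) (a : ℤ) : (kappaSeries w).coeff a = kappa (phi (-a) w) := rfl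

/-- The generating function `∑_n ⟨w|φ^{(β)}_n e^Θ φ^{(β)}_0 e^Θ|0⟩ z^n`. -/
def genVev : E →ₗ[K] L := zSubst ∘ₗ kappaSeries

lemma coeff_genVev (w : E) (n : ℤ) : (genVev w).coeff (-n) = kappa (phiBeta n w) := by
  rw [genVev, LinearMap.comp_apply, coeff_zSubst, phiBeta, map_finsum _ (phiBeta_finite n w),
    neg_neg]
  refine finsum_congr fun m => ?_
  rw [coeff_kappaSeries, neg_neg, map_smul, smul_eq_mul]

lemma z_pow (m : ℕ) : z ^ m = HahnSeries.single (-(m : ℤ)) 1 := by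
  rw [z, HahnSeries.single_pow, one_pow, nsmul_eq_mul, mul_neg, mul_one]

/-- The commutator φ_{n-m} shifts the series by z^m, and the term in which b_m has moved past φ_n is
evaluated by the eigenvalue γ^m of κ. -/
lemma kappaSeries_heis {m : ℕ} (hm : Odd m) (w : E) :
    kappaSeries (heis m w) = z ^ m * kappaSeries w + HahnSeries.C (γ ^ m) * kappaSeries w := by
  ext a
  rw [HahnSeries.coeff_add, coeff_C_mul, coeff_kappaSeries, coeff_kappaSeries,
    phi_heis (odd_natCast hm), map_add, kappa_heis hm, add_comm, z_pow,
    HahnSeries.coeff_single_mul, one_mul, coeff_kappaSeries]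
  congr 4
  ring

lemma genVev_heis {m : ℕ} (hm : Odd m) (w : E) :
    genVev (heis m w) = ((z + HahnSeries.C γ) ^ m + HahnSeries.C γ ^ m) * genVev w := by
  rw [genVev, LinearMap.comp_apply, kappaSeries_heis hm, map_add, zSubst_z_pow_mul,
    zSubst_C_mul, map_pow, add_mul]
  rfl

lemma z_mul_zinv : z * zinv = 1 := by
  rw [z, zinv, HahnSeries.single_mul_single]
  norm_num

lemma C_beta_half_add : HahnSeries.C γ + HahnSeries.C γ = betaL := by
  rw [← map_add, add_halves]; rfl

/-- Substituting z ↦ z + γ in (z + γ) S = z - γ turns it into (z + β) · `genVev vac` = z. -/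
lemma genVev_vac : genVev vac = (1 + betaL * zinv)⁻¹ := by
  have h1 : z * kappaSeries vac + HahnSeries.C γ * kappaSeries vac =
      z * 1 + HahnSeries.C (-γ) * 1 := by
    ext a
    rw [HahnSeries.coeff_add, HahnSeries.coeff_add, coeff_z_mul, coeff_z_mul, coeff_C_mul,
      coeff_C_mul, coeff_kappaSeries, coeff_kappaSeries, neg_add, ← sub_eq_add_neg, kappa_phi_vac,
      HahnSeries.coeff_one, HahnSeries.coeff_one]
    rcases eq_or_ne a (-1) with rfl | ha
    · simp
    · rcases eq_or_ne a 0 with rfl | ha'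
      · simp
      · rw [if_neg (by omega), if_neg (by omega), if_neg (by omega), if_neg (by omega)]
        simp
  have h2 := congrArg zSubst h1
  rw [map_add, map_add, zSubst_z_mul, zSubst_z_mul, zSubst_C_mul, zSubst_C_mul, zSubst_one] at h2
  change _ * genVev vac + _ * genVev vac = _ at h2
  refine eq_inv_of_mul_eq_one_left ?_
  have h3 := z_mul_zinv
  rw [map_neg] at h2
  linear_combination zinv * h2 - zinv * genVev vac * C_beta_half_add + h3 - genVev vac * h3

/-! ### The eigenvalues of the deformed Heisenberg operators and the exponential of 𝓗 -/

/-- `z^n - (-z-β)^n - (-β)^n`, i.e. `n` times the eigenvalue of the coefficient of `p_n` in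
`𝓗^{(β)}`. -/
def nu (n : ℕ) : L := z ^ n - (-z - betaL) ^ n - (-betaL) ^ n

/-- Each odd power X^k of the defining polynomial P contributes (z + γ)^k + γ^k, so the multiplier
is P(z + γ) + P(γ). The hypothesis n ≠ 0 makes the term (γ - γ)^n in P(γ) vanish. -/
lemma genVev_heisBeta {n : ℕ} (hn : n ≠ 0) (w : E) :
    (2 : L) * genVev (heisBeta n w) = nu n * genVev w := by
  have h1 : genVev (heisBeta n w) =
      ((heisBetaPoly n).eval₂ HahnSeries.C (z + HahnSeries.C γ) +
        (heisBetaPoly n).eval₂ HahnSeries.C (HahnSeries.C γ)) * genVev w := by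
    rw [heisBeta, Polynomial.sum_def, map_sum, Polynomial.eval₂_eq_sum_range,
      Polynomial.eval₂_eq_sum_range, ← Finset.sum_add_distrib, Finset.sum_mul]
    have hsub : (heisBetaPoly n).support ⊆ Finset.range ((heisBetaPoly n).natDegree + 1) :=
      Polynomial.supp_subset_range (Nat.lt_succ_self _)
    rw [Finset.sum_subset hsub (fun k _ hk => by
      rw [Polynomial.notMem_support_iff.1 hk, zero_smul, map_zero])]
    refine Finset.sum_congr rfl fun k _ => ?_
    rw [map_smul, ← HahnSeries.C_mul_eq_smul]
    rcases Nat.even_or_odd k with hk | hk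
    · rw [heisBetaPoly_coeff_even n hk, map_zero]
      ring
    · rw [genVev_heis hk]
      ring
  have h2 : (HahnSeries.C (1 / 2) : L) * 2 = 1 := by
    have : (2 : L) = HahnSeries.C 2 := (map_ofNat _ 2).symm
    rw [this, ← map_mul]
    simp
  rw [h1, heisBetaPoly, nu, ← C_beta_half_add]
  simp only [Polynomial.eval₂_mul, Polynomial.eval₂_sub, Polynomial.eval₂_pow,
    Polynomial.eval₂_neg, Polynomial.eval₂_C, Polynomial.eval₂_X]
  have h4 : (HahnSeries.C γ - HahnSeries.C γ : L) ^ n = 0 := by rw [sub_self, zero_pow hn]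
  rw [h4]
  have e1 : z + HahnSeries.C γ - HahnSeries.C γ = z := by ring
  have e2 : -(z + HahnSeries.C γ) - HahnSeries.C γ = -z - (HahnSeries.C γ + HahnSeries.C γ) := by
    ring
  have e3 : -HahnSeries.C γ - HahnSeries.C γ = -(HahnSeries.C γ + HahnSeries.C γ : L) := by ring
  rw [e1, e2, e3]
  linear_combination ((z ^ n - (-z - (HahnSeries.C γ + HahnSeries.C γ)) ^ n) -
    (-(HahnSeries.C γ + HahnSeries.C γ)) ^ n) * genVev w * h2

/-- The coefficient of `p^α` in `exp(∑_n ν_n p_n / n)`. -/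
def expCoeff (α : ℕ+ →₀ ℕ) : L :=
  α.prod fun n k => ((k.factorial : L)⁻¹) * (((n : ℕ) : L)⁻¹ * nu n) ^ k

instance charZero_L : CharZero L :=
  charZero_of_injective_ringHom (f := (HahnSeries.C : K →+* L)) HahnSeries.C_injective

/-- This is the derivative of exp(∑ ν_n p_n / n) with respect to p_n, read off on coefficients. -/
lemma expCoeff_succ (α : ℕ+ →₀ ℕ) {n : ℕ+} (hn : n ∈ α.support) :
    (α n : L) * expCoeff α =
      ((n : ℕ) : L)⁻¹ * nu n * expCoeff (α - Finsupp.single n 1) := by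
  have h0 : ∀ i : ℕ+, (((0 : ℕ).factorial : L)⁻¹) * (((i : ℕ) : L)⁻¹ * nu i) ^ 0 = 1 := by
    intro i; simp
  have her : Finsupp.erase n (α - Finsupp.single n 1) = Finsupp.erase n α := by
    ext i
    rcases eq_or_ne i n with rfl | h
    · simp
    · simp [Finsupp.erase_ne h, h]
  obtain ⟨k, hk⟩ := Nat.exists_eq_succ_of_ne_zero (Finsupp.mem_support_iff.1 hn)
  have hk' : (α - Finsupp.single n 1 : ℕ+ →₀ ℕ) n = k := by simp [hk]
  rw [expCoeff, expCoeff, ← Finsupp.mul_prod_erase' α n _ h0,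
    ← Finsupp.mul_prod_erase' (α - Finsupp.single n 1) n _ h0, her, hk', hk]
  have n1 : ((k + 1 : ℕ) : L) ≠ 0 := by exact_mod_cast k.succ_ne_zero
  rw [Nat.succ_eq_add_one, Nat.factorial_succ, Nat.cast_mul, mul_inv, pow_succ]
  linear_combination ((k.factorial : L)⁻¹) * (((n : ℕ) : L)⁻¹ * nu n) ^ k *
    (((n : ℕ) : L)⁻¹ * nu n) * (Finsupp.erase n α).prod
      (fun n k => ((k.factorial : L)⁻¹) * (((n : ℕ) : L)⁻¹ * nu n) ^ k) * mul_inv_cancel₀ n1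

lemma smul_genVev_heisBeta (n : ℕ+) (w : E) :
    genVev ((2 / ((n : ℕ) : K)) • heisBeta n w) = ((n : ℕ) : L)⁻¹ * nu n * genVev w := by
  have h := genVev_heisBeta n.ne_zero w
  have h1 : HahnSeries.C (2 / ((n : ℕ) : K)) = (2 * ((n : ℕ) : L)⁻¹ : L) := by
    rw [map_div₀, map_ofNat, map_natCast, div_eq_mul_inv]
  rw [map_smul, ← HahnSeries.C_mul_eq_smul, h1]
  linear_combination ((n : ℕ) : L)⁻¹ * h

/-- The r-th iterate is homogeneous of degree r in the p_n. In the inductive step the factors α_n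
from `expCoeff_succ` add up to r + 1, which completes the factorial. -/
lemma genVev_Hbeta_iterate (w : E) (r : ℕ) (α : ℕ+ →₀ ℕ) :
    genVev (Hbeta^[r] (constEP w) α) =
      if α.degree = r then (r.factorial : L) * expCoeff α * genVev w else 0 := by
  induction r generalizing α with
  | zero =>
    have : α.degree = 0 ↔ α = 0 := Finsupp.degree_eq_zero_iff α
    simp only [Function.iterate_zero, id_eq, constEP, this]
    split_ifs with h
    · simp [h, expCoeff]
    · exact map_zero _
  | succ r ih =>
    rw [Function.iterate_succ_apply', Hbeta, map_sum]
    have hdeg : ∀ n ∈ α.support, (α - Finsupp.single n 1).degree + 1 = α.degree := by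
      intro n hn
      have h1 : Finsupp.single n 1 ≤ α := by
        rw [Finsupp.single_le_iff]
        have := Finsupp.mem_support_iff.1 hn
        omega
      conv_rhs => rw [← tsub_add_cancel_of_le h1, map_add, Finsupp.degree_single]
    by_cases h : α.degree = r + 1
    · rw [if_pos h]
      have h2 : ∀ n ∈ α.support, genVev ((2 / ((n : ℕ) : K)) •
          heisBeta n (Hbeta^[r] (constEP w) (α - Finsupp.single n 1))) =
          (α n : L) * ((r.factorial : L) * expCoeff α * genVev w) := by
        intro n hn
        rw [smul_genVev_heisBeta, ih, if_pos (by have := hdeg n hn; omega)]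
        linear_combination -(r.factorial : L) * genVev w * expCoeff_succ α hn
      rw [Finset.sum_congr rfl h2, ← Finset.sum_mul, ← Nat.cast_sum]
      have h3 : ∑ n ∈ α.support, α n = r + 1 := h
      rw [h3, Nat.factorial_succ]
      push_cast
      ring
    · rw [if_neg h]
      refine Finset.sum_eq_zero fun n hn => ?_
      rw [smul_genVev_heisBeta, ih, if_neg (by have := hdeg n hn; omega), mul_zero]

lemma genVev_expHbeta (w : E) (α : ℕ+ →₀ ℕ) :
    genVev (expHbeta (constEP w) α) = expCoeff α * genVev w := by
  have hf : (Function.support fun r : ℕ =>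
      ((r.factorial : K)⁻¹) • Hbeta^[r] (constEP w) α).Finite := expHbeta_finite w α
  rw [expHbeta, map_finsum _ hf, finsum_eq_single _ α.degree]
  · rw [map_smul, genVev_Hbeta_iterate, if_pos rfl, ← HahnSeries.C_mul_eq_smul, map_inv₀,
      map_natCast, mul_assoc, inv_mul_cancel_left₀]
    exact_mod_cast α.degree.factorial_ne_zero
  · intro r hr
    rw [map_smul, genVev_Hbeta_iterate, if_neg (Ne.symm hr), smul_zero]

lemma vev_apply (n : ℤ) (α : ℕ+ →₀ ℕ) :
    vev n α = (expCoeff α * (1 + betaL * zinv)⁻¹).coeff (-n) := by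
  rw [← genVev_vac, ← genVev_expHbeta, coeff_genVev]
  rfl

/-! ### Products of univariate series in distinct variables -/

/-- A univariate series, viewed as a series in the variable `X_i`. -/
def inVar {σ A : Type*} [CommRing A] (i : σ) : PowerSeries A →+* MvPowerSeries σ A :=
  (MvPowerSeries.rename (R := A) (Function.Embedding.punit i)).toRingHom

lemma inVar_X {σ A : Type*} [CommRing A] (i : σ) :
    inVar i (PowerSeries.X : PowerSeries A) = MvPowerSeries.X i :=
  MvPowerSeries.rename_X _ _

lemma inVar_C {σ A : Type*} [CommRing A] (i : σ) (a : A) :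
    inVar i (PowerSeries.C a) = MvPowerSeries.C a :=
  MvPowerSeries.rename_C _ _

open scoped Classical in
lemma coeff_inVar {σ A : Type*} [CommRing A] (i : σ) (f : PowerSeries A) (d : σ →₀ ℕ) :
    MvPowerSeries.coeff d (inVar i f) =
      if d = Finsupp.single i (d i) then PowerSeries.coeff (d i) f else 0 := by
  have h : ∀ e : Unit →₀ ℕ, Finsupp.embDomain (Function.Embedding.punit i) e =
      Finsupp.single i (e ()) := by
    intro e
    conv_lhs => rw [Finsupp.unique_single e, Finsupp.embDomain_single]
    rfl
  split_ifs with hd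
  · have h2 := MvPowerSeries.coeff_embDomain_rename (Function.Embedding.punit i) f
      (Finsupp.single () (d i))
    rw [h, Finsupp.single_eq_same, ← hd] at h2
    exact h2
  · refine MvPowerSeries.coeff_rename_eq_zero _ _ ?_
    rintro ⟨e, he⟩
    rw [← Finsupp.embDomain_eq_mapDomain, h] at he
    apply hd
    rw [← he, Finsupp.single_eq_same]

open scoped Classical in
-- The factors involve distinct variables, so a monomial splits in only one way: its power of X_j
-- comes from the j-th factor.
lemma coeff_prod_inVar {σ A : Type*} [CommRing A] (s : Finset σ) (f : PowerSeries A)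
    (d : σ →₀ ℕ) : MvPowerSeries.coeff d (∏ i ∈ s, inVar i f) =
      if d.support ⊆ s then ∏ i ∈ s, PowerSeries.coeff (d i) f else 0 := by
  induction s using Finset.induction_on generalizing d with
  | empty =>
    rw [Finset.prod_empty, MvPowerSeries.coeff_one, Finset.prod_empty]
    exact if_congr (by rw [Finset.subset_empty, Finsupp.support_eq_empty]) rfl rfl
  | insert j s hj ih =>
    rw [Finset.prod_insert hj, MvPowerSeries.coeff_mul,
      Finset.sum_eq_single (Finsupp.single j (d j), d.erase j)]
    · rw [coeff_inVar, ih, Finsupp.single_eq_same, if_pos rfl, Finsupp.support_erase,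
        Finset.prod_insert hj, mul_ite, mul_zero]
      refine if_congr Finset.subset_insert_iff.symm ?_ rfl
      congr 1
      refine Finset.prod_congr rfl fun i hi => ?_
      rw [Finsupp.erase_ne (ne_of_mem_of_not_mem hi hj)]
    · rintro ⟨a, b⟩ hab hne
      rw [Finset.HasAntidiagonal.mem_antidiagonal] at hab
      simp only at hab
      rw [coeff_inVar, ih]
      split_ifs with h1 h2
      · exfalso
        have hbj : b j = 0 := by
          by_contra h
          exact hj (h2 (Finsupp.mem_support_iff.2 h))
        have haj : a j = d j := by rw [← hab, Finsupp.add_apply, hbj, add_zero]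
        rw [haj] at h1
        refine hne (Prod.ext h1 (Finsupp.ext fun i => ?_))
        rcases eq_or_ne i j with rfl | hij
        · simp [hbj]
        · simp only
          simp only at h1
          rw [Finsupp.erase_ne hij, ← hab, Finsupp.add_apply, h1,
            Finsupp.single_eq_of_ne hij, zero_add]
      all_goals simp
    · intro h
      exact absurd (by
        rw [Finset.HasAntidiagonal.mem_antidiagonal]
        exact Finsupp.single_add_erase j d) h

/-! ### The coefficients of the generating function -/

/-- The series `(1 + b X)(1 + (t + b) X) / (1 - t X)`. -/
def genSer {A : Type*} [CommRing A] (b t : A) : PowerSeries A :=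
  (1 + PowerSeries.C b * PowerSeries.X) * (1 + PowerSeries.C (t + b) * PowerSeries.X) * geomSer t

/-- This form exhibits the factor t + b, hence that the series equals 1 at t = -b. -/
lemma genSer_eq {A : Type*} [CommRing A] (b t : A) : genSer b t =
    1 + PowerSeries.C (t + b) *
      ((2 * PowerSeries.X + PowerSeries.C b * PowerSeries.X ^ 2) * geomSer t) := by
  have h := one_sub_mul_geomSer t
  rw [genSer, map_add]
  linear_combination h

lemma constantCoeff_genSer {A : Type*} [CommRing A] (b t : A) :
    PowerSeries.coeff 0 (genSer b t) = 1 := by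
  simp [genSer, geomSer]

/-- The denominator simplifies through 1 + (t + b) x̄ = (1 - t x)/(1 + b x). -/
lemma genFactor_eq {F : Type*} [Field F] (b t : F) (i : ℕ) :
    genFactor b t i = inVar i (genSer b t) := by
  have h1 : (1 + MvPowerSeries.C b * MvPowerSeries.X i : MvPowerSeries ℕ F) *
      (1 + MvPowerSeries.C b * MvPowerSeries.X i)⁻¹ = 1 :=
    MvPowerSeries.mul_inv_cancel _ (by simp)
  have h2 : (1 + MvPowerSeries.C (t + b) * xbar b i) *
      (1 + MvPowerSeries.C (t + b) * xbar b i)⁻¹ = 1 :=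
    MvPowerSeries.mul_inv_cancel _ (by simp [xbar])
  have h3 : (1 - MvPowerSeries.C t * MvPowerSeries.X i) * inVar i (geomSer t) = 1 := by
    have := congrArg (inVar i) (one_sub_mul_geomSer t)
    rwa [map_mul, map_sub, map_one, map_mul, inVar_X, inVar_C] at this
  have h4 : inVar i (genSer b t) = (1 + MvPowerSeries.C b * MvPowerSeries.X i) *
      (1 + MvPowerSeries.C (t + b) * MvPowerSeries.X i) * inVar i (geomSer t) := by
    rw [genSer, map_mul, map_mul, map_add, map_add, map_mul, map_mul, map_one, inVar_X, inVar_C,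
      inVar_C]
  rw [h4, genFactor]
  set u := (1 + MvPowerSeries.C (t + b) * xbar b i)⁻¹
  have h5 : (1 + MvPowerSeries.C (t + b) * xbar b i) *
      (1 + MvPowerSeries.C b * MvPowerSeries.X i) = 1 - MvPowerSeries.C t * MvPowerSeries.X i := by
    rw [xbar, map_add]
    linear_combination -(MvPowerSeries.C t + MvPowerSeries.C b) * MvPowerSeries.X i * h1
  linear_combination -(1 + MvPowerSeries.C (t + b) * MvPowerSeries.X i) * (u * h3 -
    (1 + MvPowerSeries.C b * MvPowerSeries.X i) * inVar i (geomSer t) * h2 +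
    u * inVar i (geomSer t) * h5)

lemma coeff_infProd {F : Type*} [Field F] (b t : F) (d : ℕ →₀ ℕ) :
    MvPowerSeries.coeff d (infProd (genFactor b t)) =
      d.prod fun _ k => PowerSeries.coeff k (genSer b t) := by
  have hsub : d.support ⊆ Finset.range (d.support.sup fun i => i + 1) := fun i hi =>
    Finset.mem_range.2 (Finset.le_sup (f := fun i => i + 1) hi)
  change MvPowerSeries.coeff d (∏ i ∈ Finset.range (d.support.sup fun i => i + 1),
    genFactor b t i) = _
  classical
  rw [Finset.prod_congr rfl fun i _ => genFactor_eq b t i, coeff_prod_inVar, if_pos hsub,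
    Finsupp.prod_of_support_subset d hsub]
  exact fun _ _ => constantCoeff_genSer b t

/-- The logarithmic derivative of a product of linear factors is a sum of geometric series. The
final +1 removes their constant terms, leaving the coefficients t^n - (-t-b)^n - (-b)^n for n ≥ 1.
-/
lemma derivative_genSer {A : Type*} [CommRing A] (b t : A) :
    PowerSeries.X * PowerSeries.derivative A (genSer b t) =
      (geomSer t - geomSer (-t - b) - geomSer (-b) + 1) * genSer b t := by
  have h1 := one_sub_mul_geomSer t
  have h2 := one_sub_mul_geomSer (-t - b)
  have h3 := one_sub_mul_geomSer (-b)
  rw [map_sub, map_neg] at h2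
  rw [map_neg] at h3
  have h4 : PowerSeries.derivative A (geomSer t) = PowerSeries.C t * geomSer t ^ 2 := by
    have := congrArg (PowerSeries.derivative A) h1
    simp only [map_sub, Derivation.leibniz, Derivation.map_one_eq_zero, smul_eq_mul,
      PowerSeries.derivative_X, PowerSeries.derivative_C] at this
    linear_combination geomSer t * this - PowerSeries.derivative A (geomSer t) * h1
  simp only [genSer, map_add, Derivation.leibniz, Derivation.map_one_eq_zero, smul_eq_mul,
    PowerSeries.derivative_X, PowerSeries.derivative_C]
  rw [h4]
  set B : PowerSeries A := PowerSeries.C b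
  set T : PowerSeries A := PowerSeries.C t
  set X : PowerSeries A := PowerSeries.X
  set G := geomSer t
  linear_combination (-(1 + B * X) * (1 + (T + B) * X) * G) * h1 +
    (1 + B * X) * G * h2 + (1 + (T + B) * X) * G * h3

lemma coeff_genSer_rec {k : ℕ} (hk : k ≠ 0) : (k : L) * PowerSeries.coeff k (genSer betaL z) =
    ∑ n ∈ Finset.range k, nu (n + 1) * PowerSeries.coeff (k - (n + 1)) (genSer betaL z) := by
  have h := congrArg (PowerSeries.coeff k) (derivative_genSer betaL z)
  obtain ⟨k, rfl⟩ := Nat.exists_eq_succ_of_ne_zero hk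
  rw [PowerSeries.coeff_succ_X_mul, PowerSeries.coeff_derivative, PowerSeries.coeff_mul,
    Finset.Nat.sum_antidiagonal_eq_sum_range_succ (fun i j =>
      PowerSeries.coeff i (geomSer z - geomSer (-z - betaL) - geomSer (-betaL) + 1) *
        PowerSeries.coeff j (genSer betaL z)), Finset.sum_range_succ'] at h
  rw [Nat.succ_eq_add_one, mul_comm]
  push_cast
  rw [h, add_eq_left.2]
  · refine Finset.sum_congr rfl fun n _ => ?_
    rw [Nat.succ_sub_succ, mul_eq_mul_right_iff]
    left
    simp [geomSer, nu, PowerSeries.coeff_one]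
  · simp [geomSer]

/-- The coefficient of `x^d` in the infinite product. -/
def prodCoeff (d : ℕ →₀ ℕ) : L := d.prod fun _ k => PowerSeries.coeff k (genSer betaL z)

/-- The Euler operator ∑ x_i ∂_i is applied to the infinite product, with the logarithmic derivative
of each factor expanded. -/
lemma prodCoeff_rec (d : ℕ →₀ ℕ) : (d.degree : L) * prodCoeff d =
    ∑ i ∈ d.support, ∑ n ∈ Finset.range (d i),
      nu (n + 1) * prodCoeff (d - Finsupp.single i (n + 1)) := by
  have hd : (d.degree : L) = ∑ i ∈ d.support, (d i : L) := by
    rw [← Nat.cast_sum]; rfl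
  rw [hd, Finset.sum_mul]
  refine Finset.sum_congr rfl fun i hi => ?_
  have h0 : ∀ _i : ℕ, PowerSeries.coeff 0 (genSer betaL z) = 1 := fun _ => constantCoeff_genSer _ _
  rw [prodCoeff, ← Finsupp.mul_prod_erase' d i _ h0, ← mul_assoc,
    coeff_genSer_rec (Finsupp.mem_support_iff.1 hi), Finset.sum_mul]
  refine Finset.sum_congr rfl fun n _ => ?_
  have her : (d - Finsupp.single i (n + 1)).erase i = d.erase i := by
    ext j
    rcases eq_or_ne j i with rfl | h
    · simp
    · simp [Finsupp.erase_ne h, h]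
  have hi' : (d - Finsupp.single i (n + 1) : ℕ →₀ ℕ) i = d i - (n + 1) := by simp
  rw [prodCoeff, ← Finsupp.mul_prod_erase' (d - Finsupp.single i (n + 1)) i _ h0, her, hi',
    mul_assoc]

/-! ### Substitution of the power sums -/

lemma coeff_powerSum_mul (n : ℕ+) (f : MvPowerSeries ℕ K) (d : ℕ →₀ ℕ) :
    MvPowerSeries.coeff d (powerSum n * f) =
      ∑ i ∈ d.support, if (n : ℕ) ≤ d i then
        MvPowerSeries.coeff (d - Finsupp.single i (n : ℕ)) f else 0 := by
  classical
  rw [← Finset.sum_filter, MvPowerSeries.coeff_mul]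
  symm
  refine Finset.sum_of_injOn (fun i => (Finsupp.single i (n : ℕ), d - Finsupp.single i (n : ℕ)))
    ?_ ?_ ?_ ?_
  · intro i _ j _ hij
    exact ((Finsupp.single_eq_single_iff _ _ _ _).1 (Prod.ext_iff.1 hij).1).elim (fun h => h.1)
      (fun h => absurd h.1 n.ne_zero)
  · intro i hi
    rw [Finset.mem_coe, Finset.mem_filter] at hi
    rw [Finset.mem_coe, Finset.HasAntidiagonal.mem_antidiagonal]
    exact add_tsub_cancel_of_le (Finsupp.single_le_iff.2 hi.2)
  · rintro ⟨a, b⟩ hab hne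
    rw [Finset.HasAntidiagonal.mem_antidiagonal] at hab
    simp only at hab
    have : MvPowerSeries.coeff a (powerSum n) = 0 := by
      refine if_neg ?_
      rintro ⟨i, rfl⟩
      refine hne ⟨i, ?_, ?_⟩
      · have : (n : ℕ) ≤ d i := by rw [← hab]; simp
        rw [Finset.mem_coe, Finset.mem_filter, Finsupp.mem_support_iff]
        exact ⟨by have := n.pos; omega, this⟩
      · simp only
        rw [← hab, add_tsub_cancel_left]
    rw [this, zero_mul]
  · intro i _
    have : MvPowerSeries.coeff (Finsupp.single i (n : ℕ)) (powerSum n) = 1 := if_pos ⟨i, rfl⟩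
    simp only
    rw [this, one_mul]

/-- The coefficient of `x^d` in `∏_n p_n(x)^{α_n}`. -/
def powerSumCoeff (α : ℕ+ →₀ ℕ) (d : ℕ →₀ ℕ) : K :=
  MvPowerSeries.coeff d (α.prod fun n k => powerSum n ^ k)

lemma powerSumCoeff_rec {α : ℕ+ →₀ ℕ} {n : ℕ+} (hn : n ∈ α.support) (d : ℕ →₀ ℕ) :
    powerSumCoeff α d = ∑ i ∈ d.support, if (n : ℕ) ≤ d i then
      powerSumCoeff (α - Finsupp.single n 1) (d - Finsupp.single i (n : ℕ)) else 0 := by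
  have h1 : Finsupp.single n 1 + (α - Finsupp.single n 1) = α := by
    refine add_tsub_cancel_of_le (Finsupp.single_le_iff.2 ?_)
    have := Finsupp.mem_support_iff.1 hn
    omega
  rw [powerSumCoeff]
  conv_lhs => rw [← h1]
  rw [Finsupp.prod_add_index' (fun _ => pow_zero _) (fun _ _ _ => pow_add _ _ _),
    Finsupp.prod_single_index (h := fun (m : ℕ+) k => powerSum m ^ k) (pow_zero _), pow_one,
    coeff_powerSum_mul]
  rfl

lemma sum_mul_sub_single (α : ℕ+ →₀ ℕ) {n : ℕ+} (hn : n ∈ α.support) :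
    (α.sum fun m k => (m : ℕ) * k) = n + (α - Finsupp.single n 1).sum fun m k => (m : ℕ) * k := by
  have h1 : Finsupp.single n 1 + (α - Finsupp.single n 1) = α := by
    refine add_tsub_cancel_of_le (Finsupp.single_le_iff.2 ?_)
    have := Finsupp.mem_support_iff.1 hn
    omega
  conv_lhs => rw [← h1]
  rw [Finsupp.sum_add_index' (fun _ => mul_zero _) (fun _ _ _ => mul_add _ _ _),
    Finsupp.sum_single_index (mul_zero _), mul_one]

lemma degree_sub_single {σ : Type*} {d : σ →₀ ℕ} {i : σ} {k : ℕ} (h : k ≤ d i) :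
    (d - Finsupp.single i k).degree + k = d.degree := by
  conv_rhs => rw [← tsub_add_cancel_of_le (Finsupp.single_le_iff.2 h), map_add,
    Finsupp.degree_single]

/-- A product of power sums is homogeneous, with p_n of weight n. -/
lemma degree_eq_of_powerSumCoeff_ne_zero {α : ℕ+ →₀ ℕ} {d : ℕ →₀ ℕ}
    (h : powerSumCoeff α d ≠ 0) : (α.sum fun m k => (m : ℕ) * k) = d.degree := by
  obtain ⟨r, hr⟩ : ∃ r, α.degree = r := ⟨_, rfl⟩
  induction r generalizing α d with
  | zero =>
    rw [Finsupp.degree_eq_zero_iff] at hr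
    subst hr
    rw [powerSumCoeff, Finsupp.prod_zero_index] at h
    have : d = 0 := by
      classical
      by_contra h'
      rw [MvPowerSeries.coeff_one, if_neg h'] at h
      exact h rfl
    simp [this]
  | succ r ih =>
    have : α ≠ 0 := by rintro rfl; simp at hr
    obtain ⟨n, hn⟩ := Finsupp.support_nonempty_iff.2 this
    rw [powerSumCoeff_rec hn] at h
    obtain ⟨i, _, hi⟩ := Finset.exists_ne_zero_of_sum_ne_zero h
    have hle : (n : ℕ) ≤ d i := by
      by_contra h'
      rw [if_neg h'] at hi
      exact hi rfl
    rw [if_pos hle] at hi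
    have h1 := degree_sub_single (k := 1) (show 1 ≤ α n by
      have := Finsupp.mem_support_iff.1 hn; omega)
    have := ih hi (by omega)
    rw [sum_mul_sub_single α hn, this, ← degree_sub_single hle, add_comm]

lemma powerSumCoeff_finite (d : ℕ →₀ ℕ) :
    (Function.support fun α : ℕ+ →₀ ℕ => powerSumCoeff α d).Finite := by
  -- Substituting into the series with all coefficients equal to 1 loses no index α.
  have := MvPowerSeries.coeff_subst_finite hasSubst_powerSum
    (fun _ => (1 : K) : MvPowerSeries ℕ+ K) d
  refine Set.Finite.subset this fun α hα h => hα ?_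
  simp only [smul_eq_mul] at h
  exact (one_mul _).symm.trans h

lemma coeff_vevX (n : ℤ) (d : ℕ →₀ ℕ) : MvPowerSeries.coeff d (vevX n) =
    ∑ᶠ α : ℕ+ →₀ ℕ, vev n α * powerSumCoeff α d := by
  rw [vevX, MvPowerSeries.coeff_subst hasSubst_powerSum]
  rfl

/-! ### The Euler recursion for the substituted exponential -/

/-- The coefficient of `x^d` in `exp(∑_n ν_n p_n(x) / n)`. -/
def substCoeff (d : ℕ →₀ ℕ) : L :=
  ∑ᶠ α : ℕ+ →₀ ℕ, HahnSeries.C (powerSumCoeff α d) * expCoeff α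

lemma substCoeff_finite (d : ℕ →₀ ℕ) : (Function.support fun α : ℕ+ →₀ ℕ =>
    HahnSeries.C (powerSumCoeff α d) * expCoeff α).Finite :=
  (powerSumCoeff_finite d).subset fun α hα h => hα (by
    simp only at h ⊢
    rw [h, map_zero, zero_mul])

lemma coeff_vevX_eq (n : ℤ) (d : ℕ →₀ ℕ) : MvPowerSeries.coeff d (vevX n) =
    (substCoeff d * (1 + betaL * zinv)⁻¹).coeff (-n) := by
  have hfin := substCoeff_finite d
  set u : L := (1 + betaL * zinv)⁻¹ with hu
  let ev : L →+ K :=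
    { toFun := fun f => (f * u).coeff (-n)
      map_zero' := by simp
      map_add' := fun f g => by rw [add_mul, HahnSeries.coeff_add] }
  have h1 := ev.map_finsum hfin
  change (substCoeff d * u).coeff (-n) = _ at h1
  rw [h1, coeff_vevX]
  refine finsum_congr fun α => ?_
  change _ = (HahnSeries.C (powerSumCoeff α d) * expCoeff α * u).coeff (-n)
  rw [mul_assoc, coeff_C_mul, vev_apply, mul_comm]

lemma expCoeff_sum (α : ℕ+ →₀ ℕ) : ((α.sum fun m k => (m : ℕ) * k : ℕ) : L) * expCoeff α =
    ∑ m ∈ α.support, nu m * expCoeff (α - Finsupp.single m 1) := by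
  rw [Finsupp.sum, Nat.cast_sum, Finset.sum_mul]
  refine Finset.sum_congr rfl fun m hm => ?_
  have h0 : ((m : ℕ) : L) ≠ 0 := by exact_mod_cast m.ne_zero
  rw [Nat.cast_mul, mul_assoc, expCoeff_succ α hm, mul_assoc, mul_inv_cancel_left₀ h0]

/-- By homogeneity the degree of d may be replaced by the weight of α. The identity is thus the
weighted Euler operator ∑ n p_n ∂/∂p_n on the exponential, followed by splitting off one factor
p_n(x) = ∑ x_i^n. -/
lemma substCoeff_term (α : ℕ+ →₀ ℕ) (d : ℕ →₀ ℕ) :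
    (d.degree : L) * (HahnSeries.C (powerSumCoeff α d) * expCoeff α) =
      ∑ i ∈ d.support, ∑ n ∈ Finset.range (d i), if n.succPNat ∈ α.support then
        nu (n + 1) * (HahnSeries.C (powerSumCoeff (α - Finsupp.single n.succPNat 1)
          (d - Finsupp.single i (n + 1))) * expCoeff (α - Finsupp.single n.succPNat 1)) else 0 := by
  have h1 : (d.degree : L) * (HahnSeries.C (powerSumCoeff α d) * expCoeff α) =
      HahnSeries.C (powerSumCoeff α d) *
        (((α.sum fun m k => (m : ℕ) * k : ℕ) : L) * expCoeff α) := by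
    by_cases h : powerSumCoeff α d = 0
    · rw [h, map_zero, zero_mul, mul_zero, zero_mul]
    · rw [degree_eq_of_powerSumCoeff_ne_zero h, mul_left_comm]
  rw [h1, expCoeff_sum, Finset.mul_sum]
  have h2 : ∀ m ∈ α.support, HahnSeries.C (powerSumCoeff α d) *
      (nu m * expCoeff (α - Finsupp.single m 1)) = ∑ i ∈ d.support, if (m : ℕ) ≤ d i then
        nu m * (HahnSeries.C (powerSumCoeff (α - Finsupp.single m 1)
          (d - Finsupp.single i (m : ℕ))) * expCoeff (α - Finsupp.single m 1)) else 0 := by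
    intro m hm
    rw [powerSumCoeff_rec hm, map_sum, Finset.sum_mul]
    refine Finset.sum_congr rfl fun i _ => ?_
    split_ifs
    · ring
    · rw [map_zero, zero_mul]
  rw [Finset.sum_congr rfl h2, Finset.sum_comm]
  refine Finset.sum_congr rfl fun i _ => ?_
  rw [← Finset.sum_filter, ← Finset.sum_filter]
  refine Finset.sum_nbij' (fun m => m.natPred) (fun n => n.succPNat) ?_ ?_ ?_ ?_ ?_
  · intro m hm
    rw [Finset.mem_filter] at hm ⊢
    rw [Finset.mem_range, PNat.succPNat_natPred]
    refine ⟨?_, hm.1⟩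
    have := PNat.natPred_add_one m
    omega
  · intro n hn
    rw [Finset.mem_filter, Finset.mem_range] at hn
    rw [Finset.mem_filter, Nat.succPNat_coe]
    exact ⟨hn.2, by omega⟩
  · intro m _
    exact PNat.succPNat_natPred m
  · intro n _
    exact Nat.natPred_succPNat n
  · intro m _
    simp only [PNat.succPNat_natPred, PNat.natPred_add_one]

lemma finsum_shift (n : ℕ+) (g : (ℕ+ →₀ ℕ) → L) :
    (∑ᶠ α : ℕ+ →₀ ℕ, if n ∈ α.support then g (α - Finsupp.single n 1) else 0) =
      ∑ᶠ α : ℕ+ →₀ ℕ, g α := by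
  set f : (ℕ+ →₀ ℕ) → L := fun α => if n ∈ α.support then g (α - Finsupp.single n 1) else 0
  have hinj : Function.Injective fun α : ℕ+ →₀ ℕ => α + Finsupp.single n 1 :=
    add_left_injective _
  have h1 : ∀ α, g α = f (α + Finsupp.single n 1) := by
    intro α
    simp only [f]
    rw [if_pos (by simp), add_tsub_cancel_right]
  classical
  rw [finsum_congr h1, ← finsum_mem_range hinj]
  refine finsum_congr fun α => ?_
  rw [finsum_eq_if]
  split_ifs with h
  · rfl
  · refine if_neg fun hn => h ⟨α - Finsupp.single n 1, tsub_add_cancel_of_le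
      (Finsupp.single_le_iff.2 ?_)⟩
    have := Finsupp.mem_support_iff.1 hn
    omega

lemma finsum_shift_finite (n : ℕ+) (g : (ℕ+ →₀ ℕ) → L) (hg : (Function.support g).Finite) :
    (Function.support fun α : ℕ+ →₀ ℕ =>
      if n ∈ α.support then g (α - Finsupp.single n 1) else 0).Finite := by
  refine (hg.image fun α : ℕ+ →₀ ℕ => α + Finsupp.single n 1).subset fun α h => ?_
  rw [Function.mem_support] at h
  have hn : n ∈ α.support := by
    by_contra h'
    exact h (if_neg h')
  rw [if_pos hn] at h
  refine ⟨α - Finsupp.single n 1, h, tsub_add_cancel_of_le (Finsupp.single_le_iff.2 ?_)⟩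
  have := Finsupp.mem_support_iff.1 hn
  omega

lemma substCoeff_rec (d : ℕ →₀ ℕ) : (d.degree : L) * substCoeff d =
    ∑ i ∈ d.support, ∑ n ∈ Finset.range (d i),
      nu (n + 1) * substCoeff (d - Finsupp.single i (n + 1)) := by
  have hfin : ∀ (i n : ℕ), (Function.support fun α : ℕ+ →₀ ℕ =>
      nu (n + 1) * (HahnSeries.C (powerSumCoeff α (d - Finsupp.single i (n + 1))) *
        expCoeff α)).Finite := fun i n =>
    (substCoeff_finite _).subset fun α hα h => hα (by
      simp only at h ⊢
      rw [h, mul_zero])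
  rw [substCoeff, mul_finsum' _ _ (substCoeff_finite d),
    finsum_congr fun α => substCoeff_term α d, finsum_sum_comm]
  · refine Finset.sum_congr rfl fun i _ => ?_
    rw [finsum_sum_comm]
    · refine Finset.sum_congr rfl fun n _ => ?_
      rw [finsum_shift n.succPNat fun α => nu (n + 1) *
        (HahnSeries.C (powerSumCoeff α (d - Finsupp.single i (n + 1))) * expCoeff α), substCoeff,
        mul_finsum' _ _ (substCoeff_finite _)]
    · intro n _
      exact finsum_shift_finite n.succPNat _ (hfin i n)
  · intro i _
    have : (⋃ n ∈ Finset.range (d i), Function.support fun α : ℕ+ →₀ ℕ =>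
      if n.succPNat ∈ α.support then
        nu (n + 1) * (HahnSeries.C (powerSumCoeff (α - Finsupp.single n.succPNat 1)
          (d - Finsupp.single i (n + 1))) * expCoeff (α - Finsupp.single n.succPNat 1))
        else 0).Finite :=
      Set.Finite.biUnion (Finset.finite_toSet _)
        fun n _ => finsum_shift_finite n.succPNat _ (hfin i n)
    refine this.subset fun α hα => ?_
    obtain ⟨n, hn, hn'⟩ := Finset.exists_ne_zero_of_sum_ne_zero hα
    exact Set.mem_biUnion (Finset.mem_coe.2 hn) hn'

lemma substCoeff_zero : substCoeff 0 = 1 := by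
  rw [substCoeff, finsum_eq_single _ 0]
  · classical
    rw [powerSumCoeff, Finsupp.prod_zero_index, MvPowerSeries.coeff_one, if_pos rfl, map_one,
      expCoeff, Finsupp.prod_zero_index, mul_one]
  · intro α hα
    by_cases h : powerSumCoeff α 0 = 0
    · rw [h, map_zero, zero_mul]
    · exfalso
      have h1 := degree_eq_of_powerSumCoeff_ne_zero h
      obtain ⟨n, hn⟩ := Finsupp.support_nonempty_iff.2 hα
      rw [sum_mul_sub_single α hn, map_zero] at h1
      have := n.pos
      omega

/-- Both families satisfy the same recursion and equal 1 at d = 0. The recursion determines them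
because the degree of d is invertible in characteristic zero. -/
lemma substCoeff_eq (d : ℕ →₀ ℕ) : substCoeff d = prodCoeff d := by
  obtain ⟨r, hr⟩ : ∃ r, d.degree = r := ⟨_, rfl⟩
  induction r using Nat.strong_induction_on generalizing d with
  | _ r ih =>
    rcases eq_or_ne d 0 with rfl | hd
    · rw [substCoeff_zero, prodCoeff, Finsupp.prod_zero_index]
    · have h0 : (d.degree : L) ≠ 0 := by
        have := (Finsupp.degree_eq_zero_iff d).not.2 hd
        exact_mod_cast this
      refine mul_left_cancel₀ h0 ?_
      rw [substCoeff_rec, prodCoeff_rec]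
      refine Finset.sum_congr rfl fun i _ => Finset.sum_congr rfl fun n hn => ?_
      rw [Finset.mem_range] at hn
      have := degree_sub_single (d := d) (i := i) (k := n + 1) hn
      rw [ih _ (by omega) _ rfl]

/-- The vacuum expectation values are the coefficients of the generating function. -/
theorem vevX_eq (n : ℤ) : vevX n = zCoeff n genGQ := by
  ext d
  rw [coeff_vevX_eq, substCoeff_eq]
  change _ = (MvPowerSeries.coeff d genGQ).coeff (-n)
  rw [genGQ, MvPowerSeries.coeff_C_mul, coeff_infProd, mul_comm]
  rfl

/-! ### The one-row `K`-theoretic `Q`-polynomials as coefficients of a rational function -/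

lemma algebraMap_beta (N : ℕ) : algebraMap K (RatF N) beta =
    algebraMap (MvPolynomial (Fin (N + 1)) K) (RatF N) (MvPolynomial.C beta) :=
  IsScalarTower.algebraMap_apply K (MvPolynomial (Fin (N + 1)) K) (RatF N) beta

lemma algebraMap_ratF_injective (N : ℕ) :
    Function.Injective (algebraMap (MvPolynomial (Fin (N + 1)) K) (RatF N)) :=
  IsFractionRing.injective _ _

lemma xvar_ne_zero {N : ℕ} (i : Fin (N + 1)) : (xvar i : RatF N) ≠ 0 := by
  rw [xvar, Ne, ← map_zero (algebraMap (MvPolynomial (Fin (N + 1)) K) (RatF N)),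
    (algebraMap_ratF_injective N).eq_iff]
  exact MvPolynomial.X_ne_zero i

lemma xvar_injective {N : ℕ} : Function.Injective (xvar : Fin (N + 1) → RatF N) := fun _ _ h =>
  MvPolynomial.X_injective (algebraMap_ratF_injective N h)

lemma one_add_beta_xvar_ne_zero {N : ℕ} (i : Fin (N + 1)) :
    1 + algebraMap K (RatF N) beta * xvar i ≠ 0 := by
  have h1 : 1 + algebraMap K (RatF N) beta * xvar i =
      algebraMap (MvPolynomial (Fin (N + 1)) K) (RatF N)
        (1 + MvPolynomial.C beta * MvPolynomial.X i) := by
    rw [map_add, map_mul, map_one, ← algebraMap_beta]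
    rfl
  rw [h1, Ne, ← map_zero (algebraMap (MvPolynomial (Fin (N + 1)) K) (RatF N)),
    (algebraMap_ratF_injective N).eq_iff]
  intro h
  have := congrArg MvPolynomial.constantCoeff h
  simp at this

/-- The coefficient `(2 + β x_i) ∏_{j ≠ i} (x_i ⊕ x_j) / (x_i ⊖ x_j)` in the partial fraction
expansion. -/
def residue {N : ℕ} (i : Fin (N + 1)) : RatF N :=
  (2 + algebraMap K (RatF N) beta * xvar i) *
    ∏ j ∈ Finset.univ.erase i, oplus (xvar i) (xvar j) / ominus (xvar i) (xvar j)

/-- The summand depends on the permutation w only through w(0). Each value is taken by N!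
permutations, which cancels the normalisation. -/
lemma GQfin_eq {n : ℕ} (hn : n ≠ 0) (N : ℕ) :
    GQfin n N = ∑ i : Fin (N + 1), residue i * xvar i ^ n := by
  have h1 : ∀ w : Equiv.Perm (Fin (N + 1)),
      oplus (xvar (w 0)) (xvar (w 0)) * xvar (w 0) ^ (n - 1) *
        ∏ j : Fin N, oplus (xvar (w 0)) (xvar (w j.succ)) / ominus (xvar (w 0)) (xvar (w j.succ)) =
      residue (w 0) * (xvar (w 0) : RatF N) ^ n := by
    intro w
    have h2 : ∏ j : Fin N,
        oplus (xvar (w 0)) (xvar (w j.succ)) / ominus (xvar (w 0)) (xvar (w j.succ)) =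
        ∏ j ∈ Finset.univ.erase (w 0), (oplus (xvar (w 0)) (xvar j) : RatF N) /
          ominus (xvar (w 0)) (xvar j) := by
      refine Finset.prod_nbij (fun j => w j.succ) ?_ ?_ ?_ ?_
      · intro j _
        simp [Fin.succ_ne_zero]
      · intro j _ k _ h
        exact Fin.succ_injective _ (w.injective h)
      · intro k hk
        rw [Finset.mem_coe, Finset.mem_erase] at hk
        have h0 : w.symm k ≠ 0 := by
          intro h
          exact hk.1 (by rw [← h, Equiv.apply_symm_apply])
        obtain ⟨j, hj⟩ := Fin.exists_succ_eq.2 h0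
        exact ⟨j, by simp, by simp only; rw [hj, Equiv.apply_symm_apply]⟩
      · intro j _
        rfl
    rw [h2, residue, oplus]
    obtain ⟨m, rfl⟩ := Nat.exists_eq_succ_of_ne_zero hn
    rw [Nat.succ_eq_add_one, Nat.add_sub_cancel]
    ring
  have h3 : ((N.factorial : ℕ) : RatF N) ≠ 0 := by
    have : CharZero (RatF N) := charZero_of_injective_algebraMap (algebraMap_ratF_injective N)
    exact_mod_cast N.factorial_ne_zero
  rw [GQfin, Finset.sum_congr rfl fun w _ => h1 w,
    ← Equiv.sum_comp (Equiv.Perm.decomposeFin (n := N)).symm, Fintype.sum_prod_type]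
  simp only [Equiv.Perm.decomposeFin_symm_apply_zero, Finset.sum_const, Finset.card_univ,
    Fintype.card_perm, Fintype.card_fin, nsmul_eq_mul]
  rw [← Finset.mul_sum, inv_mul_cancel_left₀ h3]

/-- The partial fraction expansion, with denominators cleared. -/
lemma partial_fractions (N : ℕ) :
    (Polynomial.X + Polynomial.C (algebraMap K (RatF N) beta)) *
      ∑ i : Fin (N + 1), Polynomial.C (residue i * xvar i) *
        ∏ j ∈ Finset.univ.erase i, (1 - Polynomial.C (xvar j) * Polynomial.X) =
    ∏ i : Fin (N + 1), (Polynomial.C (1 + algebraMap K (RatF N) beta * xvar i) *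
      (1 + Polynomial.C (xvar i) * (Polynomial.X + Polynomial.C (algebraMap K (RatF N) beta)))) -
    ∏ i : Fin (N + 1), (1 - Polynomial.C (xvar i : RatF N) * Polynomial.X) := by
  classical
  set b := algebraMap K (RatF N) beta with hb
  rw [← sub_eq_zero]
  -- The difference of the sides has degree at most N + 1 in z, so it suffices that it vanish at N +
  -- 2 points: z = -β and the poles z = 1/x_i.
  set s : Finset (RatF N) := insert (-b) (Finset.univ.image fun i : Fin (N + 1) => (xvar i)⁻¹)
    with hs
  have hcard : s.card = N + 2 := by
    rw [hs, Finset.card_insert_of_notMem, Finset.card_image_of_injective, Finset.card_univ,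
      Fintype.card_fin]
    · exact fun i j h => xvar_injective (inv_injective h)
    · rw [Finset.mem_image]
      rintro ⟨i, _, hi⟩
      refine one_add_beta_xvar_ne_zero i ?_
      have := xvar_ne_zero i
      rw [← hb, ← neg_eq_iff_eq_neg.2 hi]
      field_simp
      ring
  have d1 : ∀ i : Fin (N + 1), (1 - Polynomial.C (xvar i : RatF N) * Polynomial.X).natDegree ≤ 1 :=
    fun i => by
      refine (Polynomial.natDegree_sub_le _ _).trans (max_le (by simp) ?_)
      exact (Polynomial.natDegree_C_mul_le _ _).trans Polynomial.natDegree_X_le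
  refine Polynomial.eq_zero_of_natDegree_lt_card_of_eval_eq_zero' _ s ?_ ?_
  · intro x hx
    rw [hs, Finset.mem_insert, Finset.mem_image] at hx
    simp only [Polynomial.eval_sub, Polynomial.eval_mul, Polynomial.eval_add, Polynomial.eval_X,
      Polynomial.eval_C, Polynomial.eval_finsetSum, Polynomial.eval_prod, Polynomial.eval_one]
    rcases hx with rfl | ⟨i, _, rfl⟩
    -- At z = -β both products reduce to ∏ (1 + βx_i).
    · rw [neg_add_cancel, zero_mul, zero_sub, neg_eq_zero, sub_eq_zero]
      refine Finset.prod_congr rfl fun i _ => ?_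
      ring
    · have hi := xvar_ne_zero i
      have z1 : ∏ j : Fin (N + 1), (1 - xvar j * (xvar i : RatF N)⁻¹) = 0 :=
        Finset.prod_eq_zero (Finset.mem_univ i) (by rw [mul_inv_cancel₀ hi, sub_self])
      -- At z = 1/x_i only the i-th summand survives, and the equation is the defining formula of
      -- `residue i`.
      rw [z1, sub_zero, Finset.sum_eq_single i]
      · rw [← Finset.mul_prod_erase _ _ (Finset.mem_univ i), residue]
        have h2 : ∏ j ∈ Finset.univ.erase i, ((1 + b * xvar j) *
            (1 + xvar j * ((xvar i)⁻¹ + b))) =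
            (∏ j ∈ Finset.univ.erase i, oplus (xvar i) (xvar j) / ominus (xvar i) (xvar j)) *
              ∏ j ∈ Finset.univ.erase i, (1 - xvar j * (xvar i : RatF N)⁻¹) := by
          rw [← Finset.prod_mul_distrib]
          refine Finset.prod_congr rfl fun j hj => ?_
          have hij : (xvar i : RatF N) - xvar j ≠ 0 := fun h =>
            (Finset.mem_erase.1 hj).1 (xvar_injective (sub_eq_zero.1 h)).symm
          have hj' := one_add_beta_xvar_ne_zero j
          rw [← hb] at hj'
          rw [oplus, ominus, ← hb]
          field_simp
          ring
        rw [h2, ← hb]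
        field_simp
        ring
      · intro j _ hji
        rw [Finset.prod_eq_zero (Finset.mem_erase.2 ⟨hji.symm, Finset.mem_univ i⟩)
          (by rw [mul_inv_cancel₀ hi, sub_self]), mul_zero]
      · exact fun h => absurd (Finset.mem_univ i) h
  · rw [hcard]
    have e1 : (∏ i : Fin (N + 1), (1 - Polynomial.C (xvar i : RatF N) *
        Polynomial.X)).natDegree ≤ N + 1 := by
      refine (Polynomial.natDegree_prod_le _ _).trans ?_
      refine (Finset.sum_le_sum fun i _ => d1 i).trans (by simp)
    have e2 : (∏ i : Fin (N + 1), (Polynomial.C (1 + b * xvar i) *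
        (1 + Polynomial.C (xvar i) * (Polynomial.X + Polynomial.C b)))).natDegree ≤ N + 1 := by
      refine (Polynomial.natDegree_prod_le _ _).trans ?_
      refine (Finset.sum_le_sum (g := fun _ => 1) fun i _ => ?_).trans (by simp)
      refine (Polynomial.natDegree_C_mul_le _ _).trans ?_
      refine (Polynomial.natDegree_add_le _ _).trans (max_le (by simp) ?_)
      refine (Polynomial.natDegree_C_mul_le _ _).trans ?_
      rw [Polynomial.natDegree_X_add_C]
    have e3 : ((Polynomial.X + Polynomial.C b) *
        ∑ i : Fin (N + 1), Polynomial.C (residue i * xvar i) *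
          ∏ j ∈ Finset.univ.erase i,
            (1 - Polynomial.C (xvar j) * Polynomial.X)).natDegree ≤ N + 1 := by
      refine Polynomial.natDegree_mul_le.trans ?_
      rw [Polynomial.natDegree_X_add_C, add_comm]
      refine Nat.add_le_add_right ?_ 1
      refine Polynomial.natDegree_sum_le_of_forall_le _ _ fun i _ => ?_
      refine (Polynomial.natDegree_C_mul_le _ _).trans ?_
      refine (Polynomial.natDegree_prod_le _ _).trans ?_
      refine (Finset.sum_le_sum fun j _ => d1 j).trans ?_
      simp
    have := (Polynomial.natDegree_sub_le _ _).trans (max_le e3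
      ((Polynomial.natDegree_sub_le _ _).trans (max_le e2 e1)))
    omega

/-- With a = z + β this makes the quotient available over the polynomial ring, so the one-row
functions are polynomials and not merely rational functions. -/
lemma dvd_prod_one_add_mul_sub_one {ι A : Type*} [CommRing A] (s : Finset ι) (a : A) (f : ι → A) :
    a ∣ ∏ i ∈ s, (1 + a * f i) - 1 := by
  classical
  induction s using Finset.induction_on with
  | empty => simp
  | insert i s hi ih =>
    rw [Finset.prod_insert hi]
    obtain ⟨c, hc⟩ := ih
    exact ⟨c + f i * ∏ i ∈ s, (1 + a * f i), by linear_combination hc⟩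

/-! ### The generating series of the one-row polynomials, expanded at z = 0 -/

/-- The series `(1 + β x)(1 + (z + β) x) / (1 - z x)` in the variable `z`. -/
def rowFactor {A : Type*} [CommRing A] (b x : A) : PowerSeries A :=
  1 + (PowerSeries.X + PowerSeries.C b) *
    (PowerSeries.C (2 * x + b * x ^ 2) * geomSer x)

lemma map_geomSer {A B : Type*} [CommRing A] [CommRing B] (h : A →+* B) (x : A) :
    PowerSeries.map h (geomSer x) = geomSer (h x) := by
  ext n
  simp [geomSer]

lemma map_rowFactor {A B : Type*} [CommRing A] [CommRing B] (h : A →+* B) (b x : A) :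
    PowerSeries.map h (rowFactor b x) = rowFactor (h b) (h x) := by
  simp only [rowFactor, map_geomSer, map_add, map_mul, map_one, map_pow, map_ofNat,
    PowerSeries.map_X, PowerSeries.map_C]

lemma mul_rowFactor {A : Type*} [CommRing A] (b x : A) :
    (1 - PowerSeries.C x * PowerSeries.X) * rowFactor b x =
      PowerSeries.C (1 + b * x) * (1 + PowerSeries.C x * (PowerSeries.X + PowerSeries.C b)) := by
  have h := one_sub_mul_geomSer x
  rw [rowFactor]
  simp only [map_add, map_mul, map_pow, map_one, map_ofNat]
  linear_combination (PowerSeries.X + PowerSeries.C b) *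
    (2 * PowerSeries.C x + PowerSeries.C b * PowerSeries.C x ^ 2) * h

lemma prod_rowFactor_sub_one (N : ℕ) :
    ∏ i : Fin (N + 1), rowFactor (algebraMap K (RatF N) beta) (xvar i) - 1 =
      (PowerSeries.X + PowerSeries.C (algebraMap K (RatF N) beta)) *
        ∑ i : Fin (N + 1), PowerSeries.C (residue i * xvar i) * geomSer (xvar i) := by
  set b := algebraMap K (RatF N) beta with hb
  have hne : ∏ i : Fin (N + 1), (1 - PowerSeries.C (xvar i : RatF N) * PowerSeries.X) ≠ 0 := by
    refine Finset.prod_ne_zero_iff.2 fun i _ h => ?_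
    have := congrArg PowerSeries.constantCoeff h
    simp at this
  refine mul_left_cancel₀ hne ?_
  have h := congrArg (Polynomial.coeToPowerSeries.ringHom (R := RatF N)) (partial_fractions N)
  rw [← hb] at h
  simp only [map_mul, map_sub, map_add, map_sum, map_prod, map_one,
    Polynomial.coeToPowerSeries.ringHom_apply, Polynomial.coe_X, Polynomial.coe_C] at h
  rw [mul_sub, mul_one, ← Finset.prod_mul_distrib, mul_left_comm]
  have h1 : ∀ i : Fin (N + 1), (1 - PowerSeries.C (xvar i : RatF N) * PowerSeries.X) *
      rowFactor b (xvar i) = (1 + PowerSeries.C b * PowerSeries.C (xvar i)) *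
        (1 + PowerSeries.C (xvar i) * (PowerSeries.X + PowerSeries.C b)) := by
    intro i
    rw [mul_rowFactor, map_add, map_mul, map_one]
  rw [Finset.prod_congr rfl fun i _ => h1 i, ← h]
  congr 1
  rw [Finset.mul_sum]
  refine Finset.sum_congr rfl fun i _ => ?_
  rw [← Finset.mul_prod_erase Finset.univ
    (fun i : Fin (N + 1) => (1 - PowerSeries.C (xvar i : RatF N) * PowerSeries.X))
    (Finset.mem_univ i), map_mul]
  linear_combination -(∏ j ∈ Finset.univ.erase i,
    (1 - PowerSeries.C (xvar j) * PowerSeries.X)) * PowerSeries.C (residue i) *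
      PowerSeries.C (xvar i) * one_sub_mul_geomSer (xvar i : RatF N)

/-- The one-row polynomials are the coefficients of a power series over the polynomial ring. -/
lemma exists_rowSeries (N : ℕ) : ∃ T : PowerSeries (MvPolynomial (Fin (N + 1)) K),
    ∏ i : Fin (N + 1), rowFactor (MvPolynomial.C beta) (MvPolynomial.X i) - 1 =
      (PowerSeries.X + PowerSeries.C (MvPolynomial.C beta)) * T ∧
    ∀ n, algebraMap _ (RatF N) (PowerSeries.coeff n T) = GQfin (n + 1) N := by
  obtain ⟨T, hT⟩ := dvd_prod_one_add_mul_sub_one (Finset.univ : Finset (Fin (N + 1)))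
    (PowerSeries.X + PowerSeries.C (MvPolynomial.C beta) :
      PowerSeries (MvPolynomial (Fin (N + 1)) K))
    fun i => PowerSeries.C (2 * MvPolynomial.X i + MvPolynomial.C beta * MvPolynomial.X i ^ 2) *
      geomSer (MvPolynomial.X i)
  refine ⟨T, hT, fun n => ?_⟩
  have h1 := congrArg (PowerSeries.map (algebraMap (MvPolynomial (Fin (N + 1)) K) (RatF N))) hT
  change PowerSeries.map _ (∏ i : Fin (N + 1), rowFactor (MvPolynomial.C beta) (MvPolynomial.X i)
    - 1) = _ at h1
  rw [map_sub, map_prod, map_one, map_mul, map_add, PowerSeries.map_X, PowerSeries.map_C,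
    ← algebraMap_beta] at h1
  simp only [map_rowFactor, ← algebraMap_beta] at h1
  have h2 := (prod_rowFactor_sub_one N).symm.trans h1
  have hne : (PowerSeries.X + PowerSeries.C (algebraMap K (RatF N) beta) :
      PowerSeries (RatF N)) ≠ 0 := by
    intro h
    have := congrArg (PowerSeries.coeff 1) h
    simp at this
  have h3 := congrArg (PowerSeries.coeff n) (mul_left_cancel₀ hne h2)
  rw [PowerSeries.coeff_map] at h3
  rw [← h3, GQfin_eq n.succ_ne_zero, map_sum]
  refine Finset.sum_congr rfl fun i _ => ?_
  rw [PowerSeries.coeff_C_mul, geomSer, PowerSeries.coeff_mk, pow_succ']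
  ring

/-! ### Comparison of coefficients -/

/-- The function underlying `swapHom`. -/
def swapFun {σ : Type*} (f : PowerSeries (MvPolynomial σ K)) : MvPowerSeries σ (PowerSeries K) :=
  fun d => PowerSeries.mk fun n => (PowerSeries.coeff n f).coeff d

lemma coeff_coeff_swapFun {σ : Type*} (f : PowerSeries (MvPolynomial σ K)) (d : σ →₀ ℕ) (n : ℕ) :
    PowerSeries.coeff n (MvPowerSeries.coeff d (swapFun f)) = (PowerSeries.coeff n f).coeff d :=
  PowerSeries.coeff_mk n fun n => (PowerSeries.coeff n f).coeff d

/-- Interchange of the variable of a power series with the variables of its coefficients. -/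
def swapHom (σ : Type*) :
    PowerSeries (MvPolynomial σ K) →+* MvPowerSeries σ (PowerSeries K) where
  toFun := swapFun
  map_one' := by
    classical
    refine MvPowerSeries.ext fun d => PowerSeries.ext fun n => ?_
    rw [coeff_coeff_swapFun, PowerSeries.coeff_one, MvPowerSeries.coeff_one]
    by_cases hn : n = 0 <;> by_cases hd : d = 0 <;>
      simp [hn, hd, MvPolynomial.coeff_one, PowerSeries.coeff_one, eq_comm]
  map_zero' := by
    refine MvPowerSeries.ext fun d => PowerSeries.ext fun n => ?_
    rw [coeff_coeff_swapFun]
    simp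
  map_add' f g := by
    refine MvPowerSeries.ext fun d => PowerSeries.ext fun n => ?_
    rw [map_add, map_add]
    simp only [coeff_coeff_swapFun, map_add, MvPolynomial.coeff_add]
  map_mul' f g := by
    classical
    refine MvPowerSeries.ext fun d => PowerSeries.ext fun n => ?_
    rw [MvPowerSeries.coeff_mul, map_sum, coeff_coeff_swapFun, PowerSeries.coeff_mul,
      MvPolynomial.coeff_sum]
    simp only [MvPolynomial.coeff_mul, PowerSeries.coeff_mul, coeff_coeff_swapFun]
    rw [Finset.sum_comm]

lemma coeff_coeff_swapHom {σ : Type*} (f : PowerSeries (MvPolynomial σ K)) (d : σ →₀ ℕ) (n : ℕ) :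
    PowerSeries.coeff n (MvPowerSeries.coeff d (swapHom σ f)) =
      (PowerSeries.coeff n f).coeff d :=
  coeff_coeff_swapFun f d n

lemma swapHom_X (σ : Type*) : swapHom σ PowerSeries.X = MvPowerSeries.C PowerSeries.X := by
  classical
  refine MvPowerSeries.ext fun d => PowerSeries.ext fun n => ?_
  rw [coeff_coeff_swapHom, PowerSeries.coeff_X, MvPowerSeries.coeff_C]
  by_cases hn : n = 1 <;> by_cases hd : d = 0 <;>
    simp [hn, hd, MvPolynomial.coeff_one, PowerSeries.coeff_X, eq_comm]

lemma swapHom_C_C {σ : Type*} (a : K) : swapHom σ (PowerSeries.C (MvPolynomial.C a)) =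
    MvPowerSeries.C (PowerSeries.C a) := by
  classical
  refine MvPowerSeries.ext fun d => PowerSeries.ext fun n => ?_
  rw [coeff_coeff_swapHom, PowerSeries.coeff_C, MvPowerSeries.coeff_C]
  by_cases hn : n = 0 <;> by_cases hd : d = 0 <;>
    simp [hn, hd, MvPolynomial.coeff_C, PowerSeries.coeff_C, eq_comm]

lemma swapHom_C_X {σ : Type*} (i : σ) : swapHom σ (PowerSeries.C (MvPolynomial.X i)) =
    MvPowerSeries.X i := by
  classical
  refine MvPowerSeries.ext fun d => PowerSeries.ext fun n => ?_
  rw [coeff_coeff_swapHom, PowerSeries.coeff_C, MvPowerSeries.coeff_X]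
  by_cases hn : n = 0 <;> by_cases hd : d = Finsupp.single i 1 <;>
    simp [hn, hd, MvPolynomial.coeff_X, PowerSeries.coeff_one, eq_comm]

/-- Both sides are inverses of 1 - z x_i. -/
lemma swapHom_geomSer {σ : Type*} (i : σ) : swapHom σ (geomSer (MvPolynomial.X i)) =
    inVar i (geomSer PowerSeries.X) := by
  have h1 := congrArg (swapHom σ) (one_sub_mul_geomSer (MvPolynomial.X i : MvPolynomial σ K))
  have h2 := congrArg (inVar i) (one_sub_mul_geomSer (PowerSeries.X : PowerSeries K))
  rw [map_mul, map_sub, map_mul, map_one, swapHom_C_X, swapHom_X] at h1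
  rw [map_mul, map_sub, map_mul, map_one, inVar_X, inVar_C] at h2
  linear_combination inVar i (geomSer PowerSeries.X) * h1 -
    swapHom σ (geomSer (MvPolynomial.X i)) * h2

lemma swapHom_rowFactor {σ : Type*} (i : σ) :
    swapHom σ (rowFactor (MvPolynomial.C beta) (MvPolynomial.X i)) =
      inVar i (genSer (PowerSeries.C beta) PowerSeries.X) := by
  rw [genSer_eq, rowFactor]
  simp only [map_add, map_mul, map_one, map_pow, map_ofNat, swapHom_geomSer, swapHom_X,
    swapHom_C_C, swapHom_C_X, inVar_X, inVar_C]

lemma map_genSer {A B : Type*} [CommRing A] [CommRing B] (h : A →+* B) (b t : A) :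
    PowerSeries.map h (genSer b t) = genSer (h b) (h t) := by
  simp only [genSer, map_geomSer, map_add, map_mul, map_one, PowerSeries.map_X, PowerSeries.map_C]

/-- The product of the coefficients of `genSer` is congruent to its value at `z = -β`. -/
lemma exists_quotient {σ : Type*} [Fintype σ] [DecidableEq σ] (d : σ →₀ ℕ) :
    ∃ q : Polynomial K, ∏ i, PowerSeries.coeff (d i) (genSer (Polynomial.C beta) Polynomial.X) =
      (Polynomial.X + Polynomial.C beta) * q + if d = 0 then 1 else 0 := by
  set p : Polynomial K :=
    ∏ i, PowerSeries.coeff (d i) (genSer (Polynomial.C beta) Polynomial.X) with hp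
  -- Every positive-degree coefficient of `genSer` vanishes at z = -β, so the product there is 1 or
  -- 0 according to whether d = 0.
  have hroot : (p - if d = 0 then 1 else 0).IsRoot (-beta) := by
    have h1 : ∀ k, (PowerSeries.coeff k (genSer (Polynomial.C beta) Polynomial.X)).eval (-beta) =
        if k = 0 then 1 else 0 := by
      intro k
      have h2 := congrArg (PowerSeries.coeff k) (map_genSer (Polynomial.evalRingHom (-beta))
        (Polynomial.C beta) Polynomial.X)
      rw [PowerSeries.coeff_map, Polynomial.coe_evalRingHom] at h2
      rw [h2, Polynomial.eval_C, Polynomial.eval_X, genSer_eq, neg_add_cancel, map_zero, zero_mul,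
        add_zero, PowerSeries.coeff_one]
    rw [Polynomial.IsRoot, Polynomial.eval_sub, hp, Polynomial.eval_prod,
      Finset.prod_congr rfl fun i _ => h1 (d i)]
    by_cases hd : d = 0
    · simp [hd]
    · obtain ⟨i, hi⟩ := Finsupp.support_nonempty_iff.2 hd
      rw [Finset.prod_eq_zero (Finset.mem_univ i) (if_neg (Finsupp.mem_support_iff.1 hi)),
        if_neg hd]
      simp
  obtain ⟨q, hq⟩ := Polynomial.dvd_iff_isRoot.2 hroot
  rw [map_neg, sub_neg_eq_add] at hq
  exact ⟨q, by rw [← hq]; ring⟩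

lemma coeff_eval₂_z (q : Polynomial K) (m : ℕ) :
    (q.eval₂ HahnSeries.C z).coeff (-(m : ℤ)) = q.coeff m := by
  induction q using Polynomial.induction_on' with
  | add p q hp hq => rw [Polynomial.eval₂_add, HahnSeries.coeff_add, hp, hq, Polynomial.coeff_add]
  | monomial k a =>
    rw [Polynomial.eval₂_monomial, coeff_C_mul, z_pow, HahnSeries.coeff_single,
      Polynomial.coeff_monomial]
    by_cases h : k = m
    · simp [h]
    · rw [if_neg h, if_neg (by omega), mul_zero]

/-- The series is the vacuum generating function, and for n > 0 the operator φ^{(β)}_n involves only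
φ_m with m ≥ n, all of which annihilate ⟨0|. -/
lemma coeff_inv_one_add_of_pos {n : ℤ} (hn : 0 < n) :
    ((1 + betaL * zinv)⁻¹ : L).coeff (-n) = 0 := by
  rw [← genVev_vac, coeff_genVev, phiBeta, finsum_eq_zero_of_forall_eq_zero, map_zero]
  intro m
  rcases lt_or_ge m n with h | h
  · rw [phiBetaCoeff_eq_zero h, zero_smul]
  · rw [phi_vac (by omega), smul_zero]

lemma one_add_ne_zero : (1 + betaL * zinv : L) ≠ 0 := by
  intro h
  have h1 := congrArg (fun f : L => f.coeff 0) h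
  simp [betaL, zinv] at h1

/-- For a fixed x-monomial the expansions at z = 0 and z = ∞ are both governed by the same
polynomial q in z, the quotient of the coefficient of the product, minus its value at z = -β, by z +
β. -/
lemma isGQLimit_zCoeff {n : ℕ} (hn : n ≠ 0) : IsGQLimit n (zCoeff n genGQ) := by
  classical
  intro N
  obtain ⟨T, hT, hT'⟩ := exists_rowSeries N
  obtain ⟨m, rfl⟩ := Nat.exists_eq_succ_of_ne_zero hn
  -- The coefficient of z^m in T corresponds to the row n = m + 1; at infinity the matching shift is
  -- the factor z in z·q.
  refine ⟨PowerSeries.coeff m T, hT' m, fun d => ?_⟩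
  obtain ⟨q, hq⟩ := exists_quotient d
  have h1 : MvPowerSeries.coeff d (swapHom _ T) = (q : PowerSeries K) := by
    have h2 := congrArg (MvPowerSeries.coeff d) (congrArg (swapHom (Fin (N + 1))) hT)
    rw [map_sub, map_prod, map_one, map_mul, map_add, swapHom_X, swapHom_C_C, ← map_add,
      MvPowerSeries.coeff_C_mul, map_sub, Finset.prod_congr rfl fun i _ => swapHom_rowFactor i,
      coeff_prod_inVar, if_pos (Finset.subset_univ _), MvPowerSeries.coeff_one] at h2
    have h3 := congrArg (Polynomial.coeToPowerSeries.ringHom (R := K)) hq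
    rw [map_prod] at h3
    have h4 : ∀ k, Polynomial.coeToPowerSeries.ringHom
        (PowerSeries.coeff k (genSer (Polynomial.C beta) Polynomial.X)) =
        PowerSeries.coeff k (genSer (PowerSeries.C beta) (PowerSeries.X : PowerSeries K)) := by
      intro k
      rw [← PowerSeries.coeff_map, map_genSer]
      simp
    rw [Finset.prod_congr rfl fun i _ => h4 (d i)] at h3
    rw [h3, map_add, map_mul, map_add] at h2
    have hne : (PowerSeries.X + PowerSeries.C beta : PowerSeries K) ≠ 0 := by
      intro h
      have := congrArg (PowerSeries.coeff 1) h
      simp at this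
    refine mul_left_cancel₀ hne ?_
    rw [← h2]
    simp only [Polynomial.coeToPowerSeries.ringHom_apply, Polynomial.coe_X, Polynomial.coe_C]
    split_ifs <;> simp
  rw [← coeff_coeff_swapHom, h1, Polynomial.coeff_coe]
  change (MvPowerSeries.coeff (d.mapDomain Fin.val) genGQ).coeff (-((m + 1 : ℕ) : ℤ)) = _
  have h5 : (d.mapDomain Fin.val).prod (fun _ k => PowerSeries.coeff k (genSer betaL z)) =
      (z + betaL) * q.eval₂ HahnSeries.C z + if d = 0 then 1 else 0 := by
    rw [Finsupp.prod_mapDomain_index_inj Fin.val_injective, Finsupp.prod_fintype _ _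
      fun _ => constantCoeff_genSer _ _]
    have h3 := congrArg (Polynomial.eval₂RingHom (HahnSeries.C : K →+* L) z) hq
    have h4 : ∀ k, Polynomial.eval₂RingHom (HahnSeries.C : K →+* L) z
        (PowerSeries.coeff k (genSer (Polynomial.C beta) Polynomial.X)) =
        PowerSeries.coeff k (genSer betaL z) := by
      intro k
      rw [← PowerSeries.coeff_map, map_genSer]
      simp only [Polynomial.coe_eval₂RingHom, Polynomial.eval₂_C, Polynomial.eval₂_X]
      rfl
    rw [map_prod, Finset.prod_congr rfl fun i _ => h4 (d i)] at h3
    rw [h3, map_add, map_mul, map_add]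
    simp only [Polynomial.coe_eval₂RingHom, Polynomial.eval₂_C, Polynomial.eval₂_X]
    congr 1
    split_ifs <;> simp
  rw [genGQ, MvPowerSeries.coeff_C_mul, coeff_infProd, h5]
  -- Since (1 + β/z)^{-1}(z + β) = z, the prefactor is absorbed except for its contribution to the
  -- constant monomial.
  have h6 : (1 + betaL * zinv)⁻¹ * ((z + betaL) * q.eval₂ HahnSeries.C z + if d = 0 then 1 else 0) =
      z * q.eval₂ HahnSeries.C z + (1 + betaL * zinv)⁻¹ * if d = 0 then 1 else 0 := by
    have h7 := inv_mul_cancel₀ one_add_ne_zero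
    linear_combination z * q.eval₂ HahnSeries.C z * h7 - (1 + betaL * zinv)⁻¹ * betaL *
      q.eval₂ HahnSeries.C z * z_mul_zinv
  rw [h6, HahnSeries.coeff_add, coeff_z_mul]
  have h8 : (-((m + 1 : ℕ) : ℤ) + 1) = -(m : ℤ) := by push_cast; ring
  rw [h8, coeff_eval₂_z, add_eq_left]
  split_ifs
  · rw [mul_one, coeff_inv_one_add_of_pos (by positivity)]
  · rw [mul_zero, HahnSeries.coeff_zero]

/-- A monomial involves finitely many variables, so its coefficient is already determined by one of
the finite polynomials. -/
lemma IsGQLimit.unique {n : ℕ} {f g : MvPowerSeries ℕ K} (hf : IsGQLimit n f)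
    (hg : IsGQLimit n g) : f = g := by
  ext d
  set N := d.support.sup id with hN
  obtain ⟨p, hp, hp'⟩ := hf N
  obtain ⟨q, hq, hq'⟩ := hg N
  have hpq : p = q := algebraMap_ratF_injective N (hp.trans hq.symm)
  have hd : (d.comapDomain Fin.val (Fin.val_injective (n := N + 1)).injOn).mapDomain Fin.val = d := by
    refine Finsupp.mapDomain_comapDomain _ Fin.val_injective _ fun i hi => ?_
    exact ⟨⟨i, Nat.lt_succ_of_le (Finset.le_sup (f := id) hi)⟩, rfl⟩
  rw [← hd, hp', hq', hpq]

end

end KQ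

theorem mainTheorem2 :
    (∀ (n : ℤ) (f : MvPowerSeries ℕ KQ.K), KQ.IsGQ n f ↔ f = KQ.vevX n) ∧
    (∀ n : ℤ, KQ.vevX n = KQ.zCoeff n KQ.genGQ) := by
  refine ⟨fun n f => ?_, KQ.vevX_eq⟩
  rw [KQ.vevX_eq, KQ.IsGQ]
  split_ifs with hn
  · have h : KQ.IsGQLimit n.toNat (KQ.zCoeff n KQ.genGQ) := by
      have := KQ.isGQLimit_zCoeff (n := n.toNat) (by omega)
      rwa [Int.toNat_of_nonneg hn.le] at this
    -- The coefficient of z^n is a limit of the one-row polynomials, and the limit is unique.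
    exact ⟨fun hf => hf.unique h, fun hf => hf ▸ h⟩
  · exact Iff.rfl
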